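/- All spaces are real. A Köthe function space on a $\sigma$-finite measure space $(\Omega,\mu)$ is a Banach space $X$ of ($\mu$-a.e. classes of) locally integrable real functions such that $|f|\le|g|$ a.e., $f$ measurable and $g\in X$ imply $f\in X$ and $\|f\|\le\|g\|$, and such that $\chi_A\in X$ whenever $\mu(A)<\infty$. Its Köthe dual $X'$ consists of all measurable $g$ with $\int|fg|\,d\mu<\infty$ for every $f\in X$, with the norm $\|g\|_{X'}=\sup_{\|f\|_X\le1}\int|fg|\,d\mu$. The space $X$ is rearrangement invariant (r.i.) if $X'$ is a norming subspace of $X^*$, if for every invertible measure-preserving map $\tau$ of $\Omega$ one has $f\in X$ if and only if $f\circ\tau\in X$, with $\|f\circ\tau\|_X=\|f\|_X$, and if $\|\chi_B\|_X=1$ whenever $\mu(B)=1$. Here $\Omega$ is $[0,1]$ with Lebesgue measure, or one of the sets $\{1,\dots,d\}$ and $\mathbb N$ with counting measure (sequence spaces, with unit vectors $e_i$). The space $X$ has property $(P')$ if for every $t>0$ $$\|\chi_{[0,1/2]}\|_{X'}<\|\chi_{[0,1/2]}+t\chi_{[1/2,1]}\|_{X'}\quad(\Omega=[0,1]),\qquad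 \|e_1\|_{X'}<\|e_1+te_2\|_{X'}\quad(\text{sequence spaces}).$$ If $\Omega=[0,1]$, let $e^n_i=\chi_{((i-1)2^{-n},\,i2^{-n}]}$ for $1\le i\le 2^n$, and let $X_n$ be the span of $e^n_1,\dots,e^n_{2^n}$ in $X$. If $\dim X=d<\infty$, let $X_n=X$ and $e^n_i=e_i$ ($1\le i\le d$) for all $n$. If $\Omega=\mathbb N$, let $X_n$ be the span of $e^n_i=e_i$, $1\le i\le 2^n$. For a Hilbert space $H$, $X_n(H)$ is the space of families $u=(u_i)_{1\le i\le\dim X_n}$ in $H$ with norm $\big\|\sum_i\|u_i\|_H\,e^n_i\big\|_X$. An element $u$ of a normed space $E$ is a Flinn element if there is $f\in E^*$, $f\ne0$, such that $f(x)\,x^*(u)\ge0$ for all $x\in E$ and $x^*\in E^*$ with $x^*(x)=\|x\|\,\|x^*\|$. **Proposition.** Let $H$ be a separable Hilbert space with $\dim H\ge2$. Let $X$ be an r.i. space on $[0,1]$, $\{1,\dots,d\}$ or $\mathbb N$, with property $(P')$ and $\dim X\ge3$, whose norm is not proportional to the $L_p$-norm for any $1\le p\le\infty$. Then there is $N\in\mathbb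 N$ such that for every $n\ge N$ and every Flinn element $u=(u_i)$ of $X_n(H)$ there is an index $i_0$ with $u_i=0$ for all $i\ne i_0$. -/

import Mathlib

open MeasureTheory Filter
open scoped ENNReal NNReal

/-- The (class of the) characteristic function of a measurable set. -/
noncomputable def chi {Ω : Type*} [MeasurableSpace Ω] (μ : Measure Ω) (A : Set Ω)
    (hA : MeasurableSet A) : Ω →ₘ[μ] ℝ :=
  AEEqFun.mk (A.indicator fun _ => (1 : ℝ))
    (stronglyMeasurable_const.indicator hA).aestronglyMeasurable

/-- A (real) Köthe function space `X` over `(Ω, μ)`: a Banach space of `μ`-a.e. classes of locally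
integrable real functions which is an order ideal with a monotone norm and contains the
characteristic functions of sets of finite measure. The space is encoded by its extended norm
`rho` on all measurable functions: `rho f` is the norm of `f` if `f ∈ X`, and `∞` if `f ∉ X`. -/
structure KotheSpace {Ω : Type*} [MeasurableSpace Ω] (μ : Measure Ω) where
  rho : (Ω →ₘ[μ] ℝ) → ℝ≥0∞
  rho_eq_zero : ∀ f, rho f = 0 → f = 0
  rho_smul : ∀ (c : ℝ) (f : Ω →ₘ[μ] ℝ), rho (c • f) = ‖c‖ₑ * rho f
  rho_add : ∀ f g : Ω →ₘ[μ] ℝ, rho (f + g) ≤ rho f + rho g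
  rho_mono : ∀ f g : Ω →ₘ[μ] ℝ, (∀ᵐ x ∂μ, |f x| ≤ |g x|) → rho f ≤ rho g
  rho_chi : ∀ (A : Set Ω) (hA : MeasurableSet A), μ A < ∞ → rho (chi μ A hA) < ∞
  locally_integrable : ∀ f, rho f < ∞ → ∀ A : Set Ω, MeasurableSet A → μ A < ∞ →
    IntegrableOn f A μ
  complete : ∀ s : ℕ → (Ω →ₘ[μ] ℝ), (∀ n, rho (s n) < ∞) →
    (∀ ε : ℝ≥0∞, 0 < ε → ∃ N, ∀ m ≥ N, ∀ n ≥ N, rho (s m - s n) < ε) →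
    ∃ f, rho f < ∞ ∧ Tendsto (fun n => rho (s n - f)) atTop (nhds 0)

/-- Finitely many pairwise disjoint measurable sets of positive finite measure. -/
structure Blocks {Ω : Type*} [MeasurableSpace Ω] (μ : Measure Ω) (ι : Type*) where
  set : ι → Set Ω
  measurable : ∀ i, MeasurableSet (set i)
  disjoint : Pairwise fun i j => Disjoint (set i) (set j)
  pos : ∀ i, 0 < μ (set i)
  finite : ∀ i, μ (set i) < ∞

namespace KotheSpace

variable {Ω : Type*} [MeasurableSpace Ω] {μ : Measure Ω}

/-- The norm of the Köthe dual `X'`, i.e. `sup { ∫ |f| |g| dμ : ‖f‖_X ≤ 1 }`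
(`∞` if `g ∉ X'`). -/
noncomputable def dualRho (X : KotheSpace μ) (g : Ω →ₘ[μ] ℝ) : ℝ≥0∞ :=
  ⨆ (f : Ω →ₘ[μ] ℝ) (_ : X.rho f ≤ 1), ∫⁻ x, ‖f x‖ₑ * ‖g x‖ₑ ∂μ

/-- `X` is rearrangement invariant: `X'` is a norming subspace of `X*`, the norm is invariant
under invertible measure preserving maps, and `‖χ_B‖ = 1` whenever `μ B = 1`. -/
structure IsRI (X : KotheSpace μ) : Prop where
  norming : ∀ f, X.rho f < ∞ →
    X.rho f = ⨆ (g : Ω →ₘ[μ] ℝ) (_ : X.dualRho g ≤ 1), ‖∫ x, f x * g x ∂μ‖ₑ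
  invariant : ∀ (τ : Ω ≃ᵐ Ω) (hτ : MeasurePreserving τ μ μ) (f : Ω →ₘ[μ] ℝ),
    X.rho (f.compMeasurePreserving τ hτ) = X.rho f
  normalized : ∀ (B : Set Ω) (hB : MeasurableSet B), μ B = 1 → X.rho (chi μ B hB) = 1

/-- The norm of `X` is a constant multiple of the `L_p`-norm (on all of `X`). -/
def ProportionalToLp (X : KotheSpace μ) (p : ℝ≥0∞) : Prop :=
  ∃ c : ℝ≥0, ∀ f, X.rho f < ∞ → X.rho f = c * eLpNorm f p μ

end KotheSpace

/-- Property (P) of a function norm `r` relative to two sets `A`, `B`: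
`r (χ_A) < r (χ_A + t χ_B)` for every `t > 0`. -/
def PropertyP {Ω : Type*} [MeasurableSpace Ω] {μ : Measure Ω} (r : (Ω →ₘ[μ] ℝ) → ℝ≥0∞)
    (A B : Set Ω) (hA : MeasurableSet A) (hB : MeasurableSet B) : Prop :=
  ∀ t : ℝ, 0 < t → r (chi μ A hA) < r (chi μ A hA + t • chi μ B hB)

namespace KotheSpace

/-- Property (P') for a function space on `[0,1]`: `X'` has (P) for `[0,1/2]` and `[1/2,1]`. -/
def PropertyP'Interval (X : KotheSpace (volume : Measure unitInterval)) : Prop :=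
  PropertyP X.dualRho {x | (x : ℝ) ≤ 1 / 2} {x | 1 / 2 ≤ (x : ℝ)}
    (measurableSet_le measurable_subtype_coe measurable_const)
    (measurableSet_le measurable_const measurable_subtype_coe)

/-- Property (P') for a `d`-dimensional sequence space: `X'` has (P) for the first two
coordinates. -/
def PropertyP'Fin {d : ℕ} (X : KotheSpace (Measure.count : Measure (Fin d))) : Prop :=
  PropertyP X.dualRho {i | (i : ℕ) = 0} {i | (i : ℕ) = 1} (.of_discrete) (.of_discrete)

/-- Property (P') for an infinite sequence space. -/
def PropertyP'Nat (X : KotheSpace (Measure.count : Measure ℕ)) : Prop :=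
  PropertyP X.dualRho {0} {1} (.of_discrete) (.of_discrete)

section BlockSpace

variable {Ω : Type*} [MeasurableSpace Ω] {μ : Measure Ω} {ι : Type*}

/-- The space `Y(H)`, where `Y` is the span in `X` of the functions `e i = χ_{B i}`, viewed as a
sequence space with basis `(e i)`: its elements are the families `v = (v i)` in `H`, with norm
`‖ ∑ i, ‖v i‖ • e i ‖_X`. -/
def BlockSpace (_X : KotheSpace μ) (_B : Blocks μ ι) (H : Type*) : Type _ := ι → H

variable (X : KotheSpace μ) (B : Blocks μ ι)
variable (H : Type*) [NormedAddCommGroup H]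

instance : AddCommGroup (X.BlockSpace B H) := inferInstanceAs (AddCommGroup (ι → H))

instance [InnerProductSpace ℝ H] : Module ℝ (X.BlockSpace B H) :=
  inferInstanceAs (Module ℝ (ι → H))

/-- The step function `∑ i, a i • χ_{B i}`. -/
noncomputable def step [Fintype ι] (B : Blocks μ ι) (a : ι → ℝ) : Ω →ₘ[μ] ℝ :=
  ∑ i, a i • chi μ (B.set i) (B.measurable i)

noncomputable instance [Fintype ι] : Norm (X.BlockSpace B H) :=
  ⟨fun v => (X.rho (step B fun i => ‖v i‖)).toReal⟩

theorem rho_zero : X.rho 0 = 0 := by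
  have h := X.rho_smul 0 0
  simpa using h

theorem step_coeFn [Fintype ι] (a : ι → ℝ) :
    ∀ᵐ x ∂μ, step B a x = ∑ i, a i * (B.set i).indicator (fun _ => (1 : ℝ)) x := by
  classical
  have key : ∀ s : Finset ι, ∀ᵐ x ∂μ,
      (∑ i ∈ s, a i • chi μ (B.set i) (B.measurable i) : Ω →ₘ[μ] ℝ) x
        = ∑ i ∈ s, a i * (B.set i).indicator (fun _ => (1 : ℝ)) x := by
    intro s
    induction s using Finset.induction_on with
    | empty =>
      simp only [Finset.sum_empty]
      exact AEEqFun.coeFn_zero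
    | insert i s hi ih =>
      rw [Finset.sum_insert hi]
      filter_upwards [ih, AEEqFun.coeFn_add (a i • chi μ (B.set i) (B.measurable i))
          (∑ i ∈ s, a i • chi μ (B.set i) (B.measurable i)),
        AEEqFun.coeFn_smul (a i) (chi μ (B.set i) (B.measurable i)),
        AEEqFun.coeFn_mk (μ := μ) ((B.set i).indicator fun _ => (1 : ℝ))
          (stronglyMeasurable_const.indicator (B.measurable i)).aestronglyMeasurable]
        with x h1 h2 h3 h4
      rw [h2, Pi.add_apply, h1, h3, Finset.sum_insert hi, Pi.smul_apply, chi, h4, smul_eq_mul]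
  exact key Finset.univ

theorem rho_step_lt_top [Fintype ι] (a : ι → ℝ) : X.rho (step B a) < ∞ := by
  classical
  have key : ∀ s : Finset ι,
      X.rho (∑ i ∈ s, a i • chi μ (B.set i) (B.measurable i)) < ∞ := by
    intro s
    induction s using Finset.induction_on with
    | empty => simp [X.rho_zero]
    | insert i s hi ih =>
      rw [Finset.sum_insert hi]
      refine (X.rho_add _ _).trans_lt (ENNReal.add_lt_top.2 ⟨?_, ih⟩)
      rw [X.rho_smul]
      exact ENNReal.mul_lt_top (by simp) (X.rho_chi _ _ (B.finite i))
  exact key Finset.univ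

theorem step_add [Fintype ι] (a b : ι → ℝ) :
    step B (fun i => a i + b i) = step B a + step B b := by
  simp [step, add_smul, Finset.sum_add_distrib]

theorem step_mul [Fintype ι] (c : ℝ) (a : ι → ℝ) :
    step B (fun i => c * a i) = c • step B a := by
  simp [step, mul_smul, Finset.smul_sum]

theorem rho_step_mono [Fintype ι] (a b : ι → ℝ) (ha : ∀ i, 0 ≤ a i) (h : ∀ i, a i ≤ b i) :
    X.rho (step B a) ≤ X.rho (step B b) := by
  apply X.rho_mono
  filter_upwards [step_coeFn B a, step_coeFn B b] with x h1 h2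
  have hi : ∀ i, 0 ≤ (B.set i).indicator (fun _ => (1 : ℝ)) x :=
    fun i => Set.indicator_nonneg (fun _ _ => zero_le_one) x
  rw [h1, h2, abs_of_nonneg (Finset.sum_nonneg fun i _ => mul_nonneg (ha i) (hi i)),
    abs_of_nonneg (Finset.sum_nonneg fun i _ => mul_nonneg ((ha i).trans (h i)) (hi i))]
  exact Finset.sum_le_sum fun i _ => mul_le_mul_of_nonneg_right (h i) (hi i)

theorem step_eq_zero [Fintype ι] (a : ι → ℝ) (ha : ∀ i, 0 ≤ a i) (h : step B a = 0) (i : ι) :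
    a i = 0 := by
  by_contra hne
  have h0 : ∀ᵐ x ∂μ, x ∉ B.set i := by
    have hz : ∀ᵐ x ∂μ, step B a x = 0 := by
      rw [h]
      exact AEEqFun.coeFn_zero
    filter_upwards [step_coeFn B a, hz] with x h1 h2 hx
    rw [h2] at h1
    have hi : ∀ i, 0 ≤ (B.set i).indicator (fun _ => (1 : ℝ)) x :=
      fun i => Set.indicator_nonneg (fun _ _ => zero_le_one) x
    have := (Finset.sum_eq_zero_iff_of_nonneg
      (fun i _ => mul_nonneg (ha i) (hi i))).1 h1.symm i (Finset.mem_univ i)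
    simp [hx, hne] at this
  have : μ (B.set i) = 0 := by simpa [ae_iff] using h0
  exact (B.pos i).ne' this

theorem blockSpace_core [Fintype ι] [InnerProductSpace ℝ H] :
    NormedSpace.Core ℝ (X.BlockSpace B H) where
  norm_nonneg _ := ENNReal.toReal_nonneg
  norm_smul c v := by
    change (X.rho (step B fun i => ‖c • v i‖)).toReal
      = ‖c‖ * (X.rho (step B fun i => ‖v i‖)).toReal
    simp only [norm_smul]
    rw [step_mul, X.rho_smul, ENNReal.toReal_mul]
    simp
  norm_triangle v w := by
    change (X.rho (step B fun i => ‖v i + w i‖)).toReal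
      ≤ (X.rho (step B fun i => ‖v i‖)).toReal + (X.rho (step B fun i => ‖w i‖)).toReal
    rw [← ENNReal.toReal_add (X.rho_step_lt_top B _).ne (X.rho_step_lt_top B _).ne]
    refine ENNReal.toReal_mono
      (ENNReal.add_lt_top.2 ⟨X.rho_step_lt_top B _, X.rho_step_lt_top B _⟩).ne ?_
    refine (X.rho_step_mono B _ (fun i => ‖v i‖ + ‖w i‖) (fun _ => norm_nonneg _)
      fun i => norm_add_le _ _).trans ?_
    rw [step_add]
    exact X.rho_add _ _
  norm_eq_zero_iff v := by
    change (X.rho (step B fun i => ‖v i‖)).toReal = 0 ↔ v = 0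
    constructor
    · intro h
      have h' : X.rho (step B fun i => ‖v i‖) = 0 :=
        ((ENNReal.toReal_eq_zero_iff _).1 h).resolve_right (X.rho_step_lt_top B _).ne
      funext i
      exact norm_eq_zero.1 (step_eq_zero B _ (fun _ => norm_nonneg _) (X.rho_eq_zero _ h') i)
    · rintro rfl
      have : step B (fun i => ‖(0 : X.BlockSpace B H) i‖) = 0 := by
        have h0 : ∀ i, (0 : X.BlockSpace B H) i = (0 : H) := fun _ => rfl
        simp [step, h0]
      rw [this, X.rho_zero]
      rfl

noncomputable instance [Fintype ι] [InnerProductSpace ℝ H] :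
    NormedAddCommGroup (X.BlockSpace B H) :=
  NormedAddCommGroup.ofCore (X.blockSpace_core B H)

noncomputable instance [Fintype ι] [InnerProductSpace ℝ H] :
    NormedSpace ℝ (X.BlockSpace B H) :=
  NormedSpace.ofCore (X.blockSpace_core B H)

end BlockSpace

end KotheSpace

/-- The dyadic intervals `(i / 2^n, (i+1) / 2^n]`, `0 ≤ i < 2^n`, of `[0,1]`. -/
noncomputable def dyadicBlocks (n : ℕ) :
    Blocks (volume : Measure unitInterval) (Fin (2 ^ n)) where
  set i := {x | (i : ℝ) / 2 ^ n < (x : ℝ) ∧ (x : ℝ) ≤ ((i : ℝ) + 1) / 2 ^ n}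
  measurable i := (measurableSet_lt measurable_const measurable_subtype_coe).inter
    (measurableSet_le measurable_subtype_coe measurable_const)
  disjoint := by
    intro i j hij
    rw [Set.disjoint_left]
    rintro x ⟨h1, h2⟩ ⟨h3, h4⟩
    have hp : (0 : ℝ) < 2 ^ n := by positivity
    rw [div_lt_iff₀ hp] at h1 h3
    rw [le_div_iff₀ hp] at h2 h4
    have ha : (i : ℝ) < (j : ℝ) + 1 := by linarith
    have hb : (j : ℝ) < (i : ℝ) + 1 := by linarith
    norm_cast at ha hb
    exact hij (Fin.ext (by omega))
  pos i := by
    have hp : (0 : ℝ) < 2 ^ n := by positivity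
    have hi : (i : ℝ) + 1 ≤ 2 ^ n := by
      have := i.isLt
      exact_mod_cast this
    have hmem : ∀ y : ℝ, (i : ℝ) / 2 ^ n < y → y ≤ ((i : ℝ) + 1) / 2 ^ n →
        y ∈ unitInterval := fun y h1 h2 =>
      ⟨(by positivity : (0 : ℝ) ≤ (i : ℝ) / 2 ^ n).trans h1.le,
        h2.trans ((div_le_one hp).2 hi)⟩
    have himg : ((↑) : unitInterval → ℝ) ''
        {x | (i : ℝ) / 2 ^ n < (x : ℝ) ∧ (x : ℝ) ≤ ((i : ℝ) + 1) / 2 ^ n}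
        = Set.Ioc ((i : ℝ) / 2 ^ n) (((i : ℝ) + 1) / 2 ^ n) := by
      ext y
      constructor
      · rintro ⟨x, hx, rfl⟩
        exact hx
      · intro hy
        exact ⟨⟨y, hmem y hy.1 hy.2⟩, hy, rfl⟩
    have hv : (volume : Measure unitInterval)
        {x | (i : ℝ) / 2 ^ n < (x : ℝ) ∧ (x : ℝ) ≤ ((i : ℝ) + 1) / 2 ^ n}
        = volume (Set.Ioc ((i : ℝ) / 2 ^ n) (((i : ℝ) + 1) / 2 ^ n)) := by
      rw [← himg]
      exact comap_subtype_coe_apply measurableSet_Icc volume _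
    rw [hv, Real.volume_Ioc, ENNReal.ofReal_pos, sub_pos]
    gcongr
    linarith
  finite i := measure_lt_top _ _

/-- The coordinates of a `d`-dimensional sequence space. -/
def finBlocks (d : ℕ) : Blocks (Measure.count : Measure (Fin d)) (Fin d) where
  set i := {i}
  measurable _ := .of_discrete
  disjoint i j h := by simpa using h
  pos i := by simp
  finite i := by simp

/-- The first `2^n` coordinates of an infinite sequence space. -/
def natBlocks (n : ℕ) : Blocks (Measure.count : Measure ℕ) (Fin (2 ^ n)) where
  set i := {(i : ℕ)}
  measurable _ := .of_discrete
  disjoint i j h := by simpa [Fin.ext_iff] using h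
  pos i := by simp
  finite i := by simp

/-- `u` is a Flinn element of the real normed space `E`. -/
def IsFlinn {E : Type*} [NormedAddCommGroup E] [NormedSpace ℝ E] (u : E) : Prop :=
  ∃ f : E →L[ℝ] ℝ, f ≠ 0 ∧ ∀ (x : E) (φ : E →L[ℝ] ℝ), φ x = ‖x‖ * ‖φ‖ → 0 ≤ f x * φ u

/-!
Test the Flinn condition `f x * φ u ≥ 0` only on the norming pairs `x = (a i • s i)`,
`φ = ∑ i, c i * ⟪s i, ·⟫`, where the `s i` are unit vectors of `H` and `c` is a supporting
functional of `a` for the norm `N` of the coefficient space. As `dim H ≥ 2`, each coordinate copy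
of `H` contains a nonzero vector annihilated by both `f` and `⟪u i, ·⟫`. Any family of vectors in
the unit ball becomes one of unit vectors on adding multiples of these, so the condition holds for
arbitrary `s i`. It then says that two linear forms have a nonnegative product, hence are
proportional. For `a = (1, …, 1)`, whose supporting functional is constant by symmetry, this
identifies `f` as a multiple of `⟪u, ·⟫`; for general `a` it gives `a i * c j = a j * c i` whenever
`u i ≠ 0` and `u j ≠ 0`. If `u` has two nonzero coordinates, symmetry extends this to all pairs of
coordinates, so every supporting functional is proportional to the vector it supports.
Then `N / ‖·‖₂` has derivative zero, so `N` is proportional to the Euclidean norm.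

If this happens for infinitely many `n`, the norm of `X` agrees with the `L₂`-norm on a dense
subset of `L₂`, the constant being fixed by the sets of measure one. Since `X'` is norming, this
forces the norm of `X` to be the `L₂`-norm.
-/

section LinearFunctionals

section Module

variable {V : Type*} [AddCommGroup V] [Module ℝ V] {F G : V →ₗ[ℝ] ℝ}

theorem apply_mul_apply_comm_of_mul_nonneg (h : ∀ v, 0 ≤ F v * G v) (v w : V) :
    F v * G w = F w * G v := by
  have hdiscrim : discrim (F w * G w) (F v * G w + F w * G v) (F v * G v) ≤ 0 :=
    discrim_le_zero fun t => by
      have := h (v + t • w)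
      simp only [map_add, map_smul, smul_eq_mul] at this
      linarith
  rw [discrim] at hdiscrim
  nlinarith [sq_nonneg (F v * G w - F w * G v)]

theorem exists_ne_zero_apply_eq_zero (hV : 1 < Module.rank ℝ V) (F : V →ₗ[ℝ] ℝ) :
    ∃ z ≠ 0, F z = 0 := by
  have hker : LinearMap.ker F ≠ ⊥ := fun hbot => hV.not_ge <| by
    have := LinearMap.lift_rank_le_of_injective F (LinearMap.ker_eq_bot.1 hbot)
    rwa [Module.rank_self, Cardinal.lift_one, Cardinal.lift_le_one_iff] at this
  obtain ⟨z, hz, hz0⟩ := (Submodule.ne_bot_iff _).1 hker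
  exact ⟨z, hz0, hz⟩

theorem exists_ne_zero_apply_eq_zero_of_mul_nonneg (hV : 1 < Module.rank ℝ V)
    (h : ∀ v, 0 ≤ F v * G v) : ∃ z ≠ 0, F z = 0 ∧ G z = 0 := by
  rcases eq_or_ne G 0 with rfl | hG
  · obtain ⟨z, hz0, hz⟩ := exists_ne_zero_apply_eq_zero hV F
    exact ⟨z, hz0, hz, rfl⟩
  · obtain ⟨z, hz0, hz⟩ := exists_ne_zero_apply_eq_zero hV G
    obtain ⟨w, hw⟩ := DFunLike.ne_iff.1 hG
    have hFz : F z * G w = 0 := by rw [apply_mul_apply_comm_of_mul_nonneg h, hz, mul_zero]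
    exact ⟨z, hz0, (mul_eq_zero.1 hFz).resolve_right hw, hz⟩

theorem smul_pi_single {ι : Type*} [DecidableEq ι] (a : ι → ℝ) (i : ι) (z : V) :
    a • (Pi.single i z : ι → V) = a i • Pi.single i z := by
  ext j
  rcases eq_or_ne j i with rfl | hj <;> simp [*]

end Module

variable {E : Type*} [NormedAddCommGroup E] [NormedSpace ℝ E]

theorem exists_norm_add_smul_eq_one {v z : E} (hv : ‖v‖ ≤ 1) (hz : z ≠ 0) :
    ∃ t : ℝ, ‖v + t • z‖ = 1 := by
  have hlarge : 1 ≤ ‖v + (2 / ‖z‖) • z‖ := by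
    have h := norm_sub_le_norm_add ((2 / ‖z‖) • z) v
    rw [norm_smul, Real.norm_of_nonneg (by positivity),
      div_mul_cancel₀ _ (norm_ne_zero_iff.2 hz), add_comm] at h
    linarith
  exact mem_range_of_exists_le_of_exists_ge (f := fun t : ℝ => ‖v + t • z‖) (by fun_prop)
    ⟨0, by simpa using hv⟩ ⟨_, hlarge⟩

variable {ι : Type*} [Finite ι] [DecidableEq ι] {F G : (ι → E) →ₗ[ℝ] ℝ}

theorem mul_nonneg_of_forall_norm_eq_one
    (hker : ∀ i, ∃ z ≠ 0, F (Pi.single i z) = 0 ∧ G (Pi.single i z) = 0)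
    (hunit : ∀ s : ι → E, (∀ i, ‖s i‖ = 1) → 0 ≤ F s * G s) (v : ι → E) : 0 ≤ F v * G v := by
  have := Fintype.ofFinite ι
  choose z hz0 hFz hGz using hker
  have hball : ∀ v : ι → E, (∀ i, ‖v i‖ ≤ 1) → 0 ≤ F v * G v := by
    intro v hv
    choose t ht using fun i => exists_norm_add_smul_eq_one (hv i) (hz0 i)
    have hsum : (fun i => t i • z i) = ∑ i, t i • Pi.single i (z i) := by
      simp only [← Pi.single_smul]
      exact (Finset.univ_sum_single _).symm
    have hF : F (fun i => t i • z i) = 0 := by simp [hsum, hFz]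
    have hG : G (fun i => t i • z i) = 0 := by simp [hsum, hGz]
    simpa [hF, hG] using hunit (v + fun i => t i • z i) ht
  have hr : 0 < 1 + ‖v‖ := by positivity
  have hscaled := hball ((1 + ‖v‖)⁻¹ • v) fun i => by
    rw [Pi.smul_apply, norm_smul, Real.norm_of_nonneg (by positivity), inv_mul_le_one₀ hr]
    linarith [norm_le_pi_norm v i]
  rw [map_smul, map_smul, smul_mul_smul_comm, smul_eq_mul] at hscaled
  exact nonneg_of_mul_nonneg_right hscaled (by positivity)

end LinearFunctionals

section Euclidean

variable {E : Type*} [NormedAddCommGroup E] [InnerProductSpace ℝ E]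

theorem div_norm_sub_div_norm_le {N : E → ℝ} (hN0 : ∀ x, 0 ≤ N x)
    (hN : ∀ x y, N x * inner ℝ x y ≤ N y * ‖x‖ ^ 2) {x y : E} (hx : x ≠ 0) (hy : y ≠ 0) :
    N x / ‖x‖ - N y / ‖y‖ ≤ N x / ‖x‖ * (‖x - y‖ ^ 2 / (2 * ‖x‖ * ‖y‖)) := by
  have hy' := norm_pos_iff.2 hy
  have hinner : ‖x‖ * ‖y‖ - ‖x - y‖ ^ 2 / 2 ≤ inner ℝ x y := by
    linarith [norm_sub_sq_real x y, sq_nonneg (‖x‖ - ‖y‖)]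
  have hle : N x * (‖x‖ * ‖y‖ - ‖x - y‖ ^ 2 / 2) / (‖x‖ ^ 2 * ‖y‖) ≤ N y / ‖y‖ := by
    rw [div_le_div_iff₀ (by positivity) hy', ← mul_assoc]
    exact mul_le_mul_of_nonneg_right
      ((mul_le_mul_of_nonneg_left hinner (hN0 x)).trans (hN x y)) hy'.le
  refine le_trans (sub_le_sub_left hle _) (le_of_eq ?_)
  field_simp
  ring

theorem hasFDerivAt_div_norm_zero {N : E → ℝ} (hN0 : ∀ x, 0 ≤ N x)
    (hN : ∀ x y, N x * inner ℝ x y ≤ N y * ‖x‖ ^ 2) {x : E} (hx : x ≠ 0) :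
    HasFDerivAt (fun y => N y / ‖y‖) (0 : E →L[ℝ] ℝ) x := by
  have hx' := norm_pos_iff.2 hx
  have hbound : ∀ᶠ y in nhds x,
      ‖N y / ‖y‖ - N x / ‖x‖‖ ≤ 2 * (N x / ‖x‖) / ‖x‖ ^ 2 * ‖‖y - x‖ ^ 2‖ := by
    filter_upwards [Metric.ball_mem_nhds x (half_pos hx')] with y hy
    rw [Metric.mem_ball, dist_eq_norm] at hy
    have hyx : ‖x‖ / 2 ≤ ‖y‖ := by linarith [norm_sub_norm_le x y, norm_sub_rev x y]
    have hy' : 0 < ‖y‖ := (half_pos hx').trans_le hyx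
    have hy0 : y ≠ 0 := norm_pos_iff.1 hy'
    have hgx : 0 ≤ N x / ‖x‖ := div_nonneg (hN0 x) hx'.le
    have hgy : 0 ≤ N y / ‖y‖ := div_nonneg (hN0 y) hy'.le
    have hq : ‖y - x‖ ^ 2 / (2 * ‖x‖ * ‖y‖) ≤ ‖y - x‖ ^ 2 / ‖x‖ ^ 2 := by
      gcongr
      nlinarith
    have hq' : ‖y - x‖ ^ 2 / ‖x‖ ^ 2 ≤ 1 / 4 := by
      rw [div_le_iff₀ (by positivity)]
      nlinarith [norm_nonneg (y - x)]
    have hxy : N x / ‖x‖ - N y / ‖y‖ ≤ N x / ‖x‖ * (‖y - x‖ ^ 2 / ‖x‖ ^ 2) := by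
      refine (div_norm_sub_div_norm_le hN0 hN hx hy0).trans ?_
      rw [norm_sub_rev]
      exact mul_le_mul_of_nonneg_left hq hgx
    have hyx : N y / ‖y‖ - N x / ‖x‖ ≤ N y / ‖y‖ * (‖y - x‖ ^ 2 / ‖x‖ ^ 2) := by
      refine (div_norm_sub_div_norm_le hN0 hN hy0 hx).trans ?_
      rw [mul_right_comm]
      exact mul_le_mul_of_nonneg_left hq hgy
    have hq0 : 0 ≤ ‖y - x‖ ^ 2 / ‖x‖ ^ 2 := by positivity
    rw [norm_pow, norm_norm, Real.norm_eq_abs, div_mul_eq_mul_div, mul_div_assoc, abs_le]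
    constructor <;> nlinarith
  have hO : (fun y => N y / ‖y‖ - N x / ‖x‖) =O[nhds x] fun y => ‖y - x‖ ^ 2 :=
    .of_bound _ hbound
  exact hasFDerivAt_sub_const_iff _ |>.1 (hO.hasFDerivAt one_lt_two)

theorem mul_norm_eq_mul_norm_of_mul_inner_le (hE : 1 < Module.rank ℝ E) {N : E → ℝ}
    (hN0 : ∀ x, 0 ≤ N x) (hN : ∀ x y, N x * inner ℝ x y ≤ N y * ‖x‖ ^ 2) {x y : E}
    (hx : x ≠ 0) (hy : y ≠ 0) : N x * ‖y‖ = N y * ‖x‖ := by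
  have hderiv : ∀ z ∈ ({0}ᶜ : Set E), HasFDerivAt (fun y => N y / ‖y‖) (0 : E →L[ℝ] ℝ) z :=
    fun z hz => hasFDerivAt_div_norm_zero hN0 hN hz
  have hconst : N x / ‖x‖ = N y / ‖y‖ :=
    isOpen_compl_singleton.is_const_of_fderiv_eq_zero (𝕜 := ℝ)
      (isConnected_compl_singleton_of_one_lt_rank hE 0).isPreconnected
      (fun z hz => (hderiv z hz).differentiableAt.differentiableWithinAt)
      (fun z hz => (hderiv z hz).fderiv) hx hy
  rwa [div_eq_div_iff (norm_ne_zero_iff.2 hx) (norm_ne_zero_iff.2 hy)] at hconst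

end Euclidean

section SymmetricNorm

open scoped Matrix

variable {ι : Type*} [Fintype ι] {N : Seminorm ℝ (ι → ℝ)} {a c : ι → ℝ}

/-- The unit vectors of `ι → ℝ` are a `1`-symmetric basis for the norm `N`: the norm depends
neither on the signs nor on the order of the coefficients, and it increases with their absolute
values. -/
structure IsSymmetricNorm (N : Seminorm ℝ (ι → ℝ)) : Prop where
  pos : ∀ a, a ≠ 0 → 0 < N a
  mono : ∀ a b : ι → ℝ, (∀ i, |a i| ≤ |b i|) → N a ≤ N b
  comp_perm : ∀ (a : ι → ℝ) (σ : Equiv.Perm ι), N (a ∘ σ) = N a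

/-- `c` is a supporting functional of `a`: its norm dual to `N` is at most `1`, and it norms `a`. -/
def IsSupport (N : Seminorm ℝ (ι → ℝ)) (a c : ι → ℝ) : Prop :=
  (∀ b, c ⬝ᵥ b ≤ N b) ∧ c ⬝ᵥ a = N a

theorem exists_isSupport (N : Seminorm ℝ (ι → ℝ)) (a : ι → ℝ) : ∃ c, IsSupport N a c := by
  classical
  have hspan : ∀ r : ℝ, r • a = 0 → r • N a = 0 := by
    intro r hr
    rw [smul_eq_zero] at hr ⊢
    exact hr.imp_right fun ha => by rw [ha, map_zero]
  obtain ⟨g, hga, hg⟩ := Module.Dual.exists_extension_of_le_seminorm_real _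
    (LinearPMap.mkSpanSingleton' (σ := RingHom.id ℝ) a (N a) hspan).toFun (p := N) <| by
      rintro ⟨x, hx⟩
      obtain ⟨r, rfl⟩ := Submodule.mem_span_singleton.1 hx
      refine (LinearPMap.mkSpanSingleton'_apply a (N a) hspan r hx).trans_le ?_
      rw [map_smul_eq_mul]
      exact mul_le_mul_of_nonneg_right (Real.le_norm_self r) (apply_nonneg N a)
  have hdot : ∀ b, (dotProductEquiv ℝ ι).symm g ⬝ᵥ b = g b :=
    DFunLike.congr_fun ((dotProductEquiv ℝ ι).apply_symm_apply g)
  refine ⟨(dotProductEquiv ℝ ι).symm g, fun b => ?_, ?_⟩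
  · rw [hdot]
    exact (le_abs_self _).trans (hg b)
  · rw [hdot]
    exact (hga ⟨a, Submodule.mem_span_singleton_self a⟩).trans
      (LinearPMap.mkSpanSingleton'_apply_self a (N a) hspan _)

theorem card_smul_sum_comp_perm [DecidableEq ι] (b : ι → ℝ) :
    (Fintype.card ι : ℝ) • ∑ σ : Equiv.Perm ι, b ∘ σ
      = (Fintype.card (Equiv.Perm ι) * ∑ i, b i) • (1 : ι → ℝ) := by
  ext k
  have hconst : ∀ l, ∑ σ : Equiv.Perm ι, b (σ l) = ∑ σ : Equiv.Perm ι, b (σ k) := fun l => by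
    rw [← Equiv.sum_comp (Equiv.mulRight (Equiv.swap k l))]
    simp
  calc ((Fintype.card ι : ℝ) • ∑ σ : Equiv.Perm ι, b ∘ σ) k
      = ∑ l, ∑ σ : Equiv.Perm ι, b (σ l) := by simp [hconst]
    _ = ∑ σ : Equiv.Perm ι, ∑ l, b (σ l) := Finset.sum_comm
    _ = ((Fintype.card (Equiv.Perm ι) * ∑ i, b i) • (1 : ι → ℝ)) k := by
        simp [Equiv.sum_comp]

namespace IsSymmetricNorm

theorem isSupport_single [DecidableEq ι] (hN : IsSymmetricNorm N) (i : ι) :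
    IsSupport N (Pi.single i 1) (Pi.single i (N (Pi.single i 1))) := by
  refine ⟨fun b => ?_, by simp⟩
  calc Pi.single i (N (Pi.single i 1)) ⬝ᵥ b = b i * N (Pi.single i 1) := by
        rw [single_dotProduct, mul_comm]
    _ ≤ ‖b i‖ * N (Pi.single i 1) := by gcongr; exact Real.le_norm_self _
    _ = N (b i • Pi.single i 1) := (map_smul_eq_mul N _ _).symm
    _ ≤ N b := hN.mono _ _ fun j => by
        rcases eq_or_ne j i with rfl | hj <;> simp [*]

theorem isSupport_comp_perm (hN : IsSymmetricNorm N) (h : IsSupport N a c) (σ : Equiv.Perm ι) :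
    IsSupport N (a ∘ σ) (c ∘ σ) := by
  refine ⟨fun b => ?_, ?_⟩
  · rw [← dotProduct_comp_equiv_symm, ← hN.comp_perm b σ.symm]
    exact h.1 _
  · rw [comp_equiv_dotProduct_comp_equiv, hN.comp_perm, h.2]

theorem isSupport_one [Nonempty ι] (hN : IsSymmetricNorm N) :
    IsSupport N 1 (fun _ => N 1 / Fintype.card ι) := by
  classical
  have hcard : (0 : ℝ) < Fintype.card ι := by exact_mod_cast Fintype.card_pos
  have hcardPerm : (0 : ℝ) < Fintype.card (Equiv.Perm ι) := by exact_mod_cast Fintype.card_pos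
  refine ⟨fun b => ?_, by simp [dotProduct, mul_div_cancel₀ _ hcard.ne']⟩
  -- The average of `b` over all permutations is a multiple of `1`, of norm at most `N b`.
  have hsum : Fintype.card (Equiv.Perm ι) * ((∑ i, b i) * N 1)
      ≤ Fintype.card (Equiv.Perm ι) * (Fintype.card ι * N b) :=
    calc Fintype.card (Equiv.Perm ι) * ((∑ i, b i) * N 1)
        ≤ ‖Fintype.card (Equiv.Perm ι) * ∑ i, b i‖ * N 1 := by
          rw [← mul_assoc]
          exact mul_le_mul_of_nonneg_right (Real.le_norm_self _) (apply_nonneg N 1)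
      _ = Fintype.card ι * N (∑ σ : Equiv.Perm ι, b ∘ σ) := by
          rw [← map_smul_eq_mul, ← card_smul_sum_comp_perm, map_smul_eq_mul, Real.norm_natCast]
      _ ≤ Fintype.card ι * ∑ σ : Equiv.Perm ι, N (b ∘ σ) := by
          gcongr
          exact Finset.le_sum_of_subadditive N (map_zero N).le (map_add_le_add N) _ _
      _ = Fintype.card (Equiv.Perm ι) * (Fintype.card ι * N b) := by
          simp only [hN.comp_perm, Finset.sum_const, Finset.card_univ, nsmul_eq_mul]
          ring
  rw [dotProduct, ← Finset.mul_sum, div_mul_eq_mul_div, div_le_iff₀ hcard]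
  linarith [le_of_mul_le_mul_left hsum hcardPerm]

end IsSymmetricNorm

section Flinn

variable {H : Type*} [NormedAddCommGroup H] [InnerProductSpace ℝ H]

/-- The linear form `v ↦ ∑ i, c i * ⟪s i, v i⟫` on `ι → H`. If `c` is a supporting functional of
`a` and the `s i` are unit vectors, it norms the family `a • s`. -/
noncomputable def weightedInner (c : ι → ℝ) (s : ι → H) : (ι → H) →ₗ[ℝ] ℝ :=
  ∑ i, c i • innerₛₗ ℝ (s i) ∘ₗ LinearMap.proj i

theorem weightedInner_apply (c : ι → ℝ) (s v : ι → H) :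
    weightedInner c s v = ∑ i, c i * inner ℝ (s i) (v i) := by
  simp [weightedInner]

theorem weightedInner_comm (c : ι → ℝ) (s v : ι → H) :
    weightedInner c s v = weightedInner c v s := by
  simp only [weightedInner_apply, real_inner_comm]

theorem weightedInner_single [DecidableEq ι] (c : ι → ℝ) (s : ι → H) (i : ι) (z : H) :
    weightedInner c s (Pi.single i z) = c i * inner ℝ (s i) z := by
  rw [weightedInner_apply, Finset.sum_eq_single i (fun j _ hj => by simp [hj]) (by simp),
    Pi.single_eq_same]

theorem IsSupport.weightedInner_smul (h : IsSupport N a c) {s : ι → H} (hs : ∀ i, ‖s i‖ = 1) :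
    weightedInner c s (a • s) = N a := by
  rw [← h.2, weightedInner_apply, dotProduct]
  refine Finset.sum_congr rfl fun i _ => ?_
  rw [Pi.smul_apply', real_inner_smul_right, real_inner_self_eq_norm_sq, hs, one_pow, mul_one]

theorem IsSymmetricNorm.abs_weightedInner_le (hN : IsSymmetricNorm N) (h : IsSupport N a c)
    {s : ι → H} (hs : ∀ i, ‖s i‖ = 1) (v : ι → H) : |weightedInner c s v| ≤ N fun i => ‖v i‖ := by
  have hle : ∀ v, weightedInner c s v ≤ N fun i => ‖v i‖ := fun v => by
    rw [weightedInner_apply]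
    refine (h.1 fun i => inner ℝ (s i) (v i)).trans (hN.mono _ _ fun i => ?_)
    simpa [hs] using abs_real_inner_le_norm (s i) (v i)
  refine abs_le'.2 ⟨hle v, ?_⟩
  simpa using hle (-v)

/-- The linear form `F` satisfies the defining condition of a Flinn element `u`, in the space of
families `v` with norm `N (‖v i‖)`, for the norming pairs `(a • s, weightedInner c s)` with unit
vectors `s i`. -/
def IsFlinnForm (N : Seminorm ℝ (ι → ℝ)) (u : ι → H) (F : (ι → H) →ₗ[ℝ] ℝ) : Prop :=
  ∀ a c, IsSupport N a c → ∀ s : ι → H, (∀ i, ‖s i‖ = 1) →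
    0 ≤ F (a • s) * weightedInner c s u

namespace IsFlinnForm

variable {u : ι → H} {F : (ι → H) →ₗ[ℝ] ℝ}

theorem apply_single_mul_inner_nonneg [DecidableEq ι] (hF : IsFlinnForm N u F)
    (hN : IsSymmetricNorm N) (i : ι) (z : H) :
    0 ≤ F (Pi.single i z) * inner ℝ (u i) z := by
  rcases eq_or_ne z 0 with rfl | hz
  · simp
  have hr : 0 < N (Pi.single i 1) := hN.pos _ (by simp)
  have h := hF _ _ (hN.isSupport_single i) (fun _ => ‖z‖⁻¹ • z) fun _ => norm_smul_inv_norm hz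
  have hsingle : (Pi.single i (1 : ℝ) : ι → ℝ) • (fun _ => ‖z‖⁻¹ • z)
      = ‖z‖⁻¹ • (Pi.single i z : ι → H) := by
    ext j
    rcases eq_or_ne j i with rfl | hj <;> simp [*]
  have hinner : weightedInner (Pi.single i (N (Pi.single i 1))) (fun _ => ‖z‖⁻¹ • z) u
      = N (Pi.single i 1) * ‖z‖⁻¹ * inner ℝ (u i) z := by
    rw [weightedInner_apply, Finset.sum_eq_single i (fun j _ hj => by simp [hj]) (by simp),
      Pi.single_eq_same, real_inner_smul_left, real_inner_comm, mul_assoc]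
  refine nonneg_of_mul_nonneg_right (a := ‖z‖⁻¹ * (N (Pi.single i 1) * ‖z‖⁻¹)) ?_ (by positivity)
  rwa [hsingle, hinner, map_smul, smul_eq_mul, mul_mul_mul_comm] at h

theorem apply_smul_mul_weightedInner_nonneg (hF : IsFlinnForm N u F)
    (hN : IsSymmetricNorm N) (hH : 1 < Module.rank ℝ H) {a c : ι → ℝ} (hac : IsSupport N a c)
    (v : ι → H) : 0 ≤ F (a • v) * weightedInner c u v := by
  classical
  refine mul_nonneg_of_forall_norm_eq_one (F := F ∘ₗ DistribSMul.toLinearMap ℝ (ι → H) a)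
    (fun i => ?_) (fun s hs => ?_) v
  · obtain ⟨z, hz0, hFz, hGz⟩ := exists_ne_zero_apply_eq_zero_of_mul_nonneg hH
      (F := F ∘ₗ LinearMap.single ℝ (fun _ => H) i) (G := innerₛₗ ℝ (u i))
      (hF.apply_single_mul_inner_nonneg hN i)
    refine ⟨z, hz0, ?_, ?_⟩
    · rw [LinearMap.comp_apply, DistribSMul.toLinearMap_apply, smul_pi_single, map_smul,
        show F (Pi.single i z) = 0 from hFz, smul_zero]
    · rw [weightedInner_single, show inner ℝ (u i) z = 0 from hGz, mul_zero]
  · rw [weightedInner_comm]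
    exact hF a c hac s hs

theorem exists_eq_smul_weightedInner_one (hF : IsFlinnForm N u F) (hN : IsSymmetricNorm N)
    (hH : 1 < Module.rank ℝ H) (hF0 : F ≠ 0) {i : ι} (hi : u i ≠ 0) :
    ∃ κ : ℝ, κ ≠ 0 ∧ F = κ • weightedInner 1 u := by
  classical
  have : Nonempty ι := ⟨i⟩
  obtain ⟨v₀, hv₀⟩ := DFunLike.ne_iff.1 hF0
  have hN1 : 0 < N 1 := hN.pos 1 one_ne_zero
  have hsign : ∀ v, 0 ≤ F v * weightedInner 1 u v := fun v => by
    have h := hF.apply_smul_mul_weightedInner_nonneg hN hH hN.isSupport_one v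
    rw [one_smul, weightedInner_apply, ← Finset.mul_sum, mul_left_comm] at h
    simpa [weightedInner_apply] using nonneg_of_mul_nonneg_right h (by positivity)
  have hprop := apply_mul_apply_comm_of_mul_nonneg hsign
  have hui : weightedInner 1 u (Pi.single i (u i)) ≠ 0 := by simpa [weightedInner_single] using hi
  set w : ι → H := Pi.single i (u i)
  refine ⟨F w / weightedInner 1 u w, div_ne_zero (fun hw => ?_) hui, LinearMap.ext fun v => ?_⟩
  · have := hprop v₀ w
    rw [hw, zero_mul] at this
    exact (mul_ne_zero hv₀ hui) this
  · rw [LinearMap.smul_apply, smul_eq_mul, div_mul_eq_mul_div, eq_div_iff hui, hprop]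

theorem mul_eq_mul_of_isSupport (hF : IsFlinnForm N u F) (hN : IsSymmetricNorm N)
    (hH : 1 < Module.rank ℝ H) (hF0 : F ≠ 0) {a c : ι → ℝ} (hac : IsSupport N a c) {i j : ι}
    (hi : u i ≠ 0) (hj : u j ≠ 0) : a i * c j = a j * c i := by
  classical
  obtain ⟨κ, hκ, rfl⟩ := hF.exists_eq_smul_weightedInner_one hN hH hF0 hi
  have hprop := apply_mul_apply_comm_of_mul_nonneg
    (F := (κ • weightedInner 1 u) ∘ₗ DistribSMul.toLinearMap ℝ (ι → H) a)
    (hF.apply_smul_mul_weightedInner_nonneg hN hH hac) (Pi.single i (u i)) (Pi.single j (u j))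
  have hi' : κ * ‖u i‖ ^ 2 * ‖u j‖ ^ 2 ≠ 0 := by simp [*]
  refine mul_left_cancel₀ hi' ?_
  have hsmul : ∀ k, weightedInner 1 u (a • (Pi.single k (u k) : ι → H)) = a k * ‖u k‖ ^ 2 := by
    intro k
    rw [smul_pi_single, map_smul, weightedInner_single, smul_eq_mul, real_inner_self_eq_norm_sq,
      Pi.one_apply, one_mul]
  simp only [LinearMap.comp_apply, LinearMap.smul_apply, DistribSMul.toLinearMap_apply, hsmul,
    weightedInner_single, real_inner_self_eq_norm_sq] at hprop
  linear_combination hprop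

end IsFlinnForm

theorem IsSymmetricNorm.mul_eq_mul_of_isSupport_of_ne (hN : IsSymmetricNorm N) {i j : ι}
    (hij : i ≠ j) (h : ∀ a c, IsSupport N a c → a i * c j = a j * c i) (hac : IsSupport N a c)
    (k l : ι) : a k * c l = a l * c k := by
  rcases eq_or_ne k l with rfl | hkl
  · rfl
  obtain ⟨σ, hi, hj⟩ := MulAction.is_two_pretransitive_iff.1
    (Equiv.Perm.isMultiplyPretransitive ι 2) hij hkl
  simpa [← hi, ← hj] using h _ _ (hN.isSupport_comp_perm hac σ)

theorem mul_inner_le_of_isSupport_mul_eq_mul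
    (h : ∀ a c, IsSupport N a c → ∀ k l, a k * c l = a l * c k) (x y : EuclideanSpace ℝ ι) :
    N x.ofLp * inner ℝ x y ≤ N y.ofLp * ‖x‖ ^ 2 := by
  obtain ⟨c, hle, hc⟩ := exists_isSupport N x.ofLp
  have hinner : ∀ z : EuclideanSpace ℝ ι, inner ℝ x z = x.ofLp ⬝ᵥ z.ofLp := fun z => by
    rw [EuclideanSpace.inner_eq_star_dotProduct, star_trivial, dotProduct_comm]
  have hxc : N x.ofLp • x.ofLp = ‖x‖ ^ 2 • c := by
    ext k
    rw [← hc, ← real_inner_self_eq_norm_sq, hinner]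
    simp only [Pi.smul_apply, smul_eq_mul, dotProduct, Finset.sum_mul]
    exact Finset.sum_congr rfl fun l _ => by linear_combination x.ofLp l * h _ _ ⟨hle, hc⟩ k l
  calc N x.ofLp * inner ℝ x y = ‖x‖ ^ 2 * (c ⬝ᵥ y.ofLp) := by
        rw [hinner, ← smul_eq_mul, ← smul_dotProduct, hxc, smul_dotProduct, smul_eq_mul]
    _ ≤ N y.ofLp * ‖x‖ ^ 2 := by
        rw [mul_comm]
        gcongr
        exact hle _

theorem IsFlinnForm.mul_norm_eq_mul_norm {u : ι → H} {F : (ι → H) →ₗ[ℝ] ℝ}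
    (hF : IsFlinnForm N u F) (hN : IsSymmetricNorm N) (hH : 1 < Module.rank ℝ H) (hF0 : F ≠ 0)
    {i j : ι} (hij : i ≠ j) (hi : u i ≠ 0) (hj : u j ≠ 0) (a b : ι → ℝ) :
    N a * ‖WithLp.toLp 2 b‖ = N b * ‖WithLp.toLp 2 a‖ := by
  rcases eq_or_ne a 0 with rfl | ha
  · simp
  rcases eq_or_ne b 0 with rfl | hb
  · simp
  have hrank : 1 < Module.rank ℝ (EuclideanSpace ℝ ι) := by
    rw [← Module.finrank_eq_rank, finrank_euclideanSpace]
    exact_mod_cast Fintype.one_lt_card_iff.2 ⟨i, j, hij⟩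
  refine mul_norm_eq_mul_norm_of_mul_inner_le (N := fun x : EuclideanSpace ℝ ι => N x.ofLp) hrank
    (fun x => apply_nonneg N _) (mul_inner_le_of_isSupport_mul_eq_mul fun a c hac k l => ?_)
    (x := WithLp.toLp 2 a) (y := WithLp.toLp 2 b) (by simpa) (by simpa)
  exact hN.mul_eq_mul_of_isSupport_of_ne hij
    (fun a c hac => hF.mul_eq_mul_of_isSupport hN hH hF0 hac hi hj) hac k l

end Flinn

end SymmetricNorm

theorem Blocks.mem_set_iff_eq {Ω ι : Type*} [MeasurableSpace Ω] {μ : Measure Ω} (B : Blocks μ ι)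
    {x : Ω} {i : ι} (hi : x ∈ B.set i) (j : ι) : x ∈ B.set j ↔ j = i :=
  ⟨fun hj => B.disjoint.eq (Set.not_disjoint_iff.2 ⟨x, hj, hi⟩), fun h => h ▸ hi⟩

namespace KotheSpace

section BlockSpace

variable {Ω : Type*} [MeasurableSpace Ω] {μ : Measure Ω} {ι : Type*} [Fintype ι]
  (X : KotheSpace μ) (B : Blocks μ ι)

theorem step_ae_eq_of_mem (a : ι → ℝ) : ∀ᵐ x ∂μ, ∀ i, x ∈ B.set i → step B a x = a i := by
  filter_upwards [step_coeFn B a] with x hx i hi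
  rw [hx, Finset.sum_eq_single i, Set.indicator_of_mem hi, mul_one]
  · intro j _ hj
    rw [Set.indicator_of_notMem (mt (B.mem_set_iff_eq hi j).1 hj), mul_zero]
  · simp

theorem step_ae_eq_zero (a : ι → ℝ) : ∀ᵐ x ∂μ, (∀ i, x ∉ B.set i) → step B a x = 0 := by
  filter_upwards [step_coeFn B a] with x hx h
  simp [hx, h]

theorem rho_step_le_of_abs_le {a b : ι → ℝ} (h : ∀ i, |a i| ≤ |b i|) :
    X.rho (step B a) ≤ X.rho (step B b) := by
  apply X.rho_mono
  filter_upwards [step_ae_eq_of_mem B a, step_ae_eq_of_mem B b, step_ae_eq_zero B a]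
    with x ha hb ha0
  by_cases hx : ∃ i, x ∈ B.set i
  · obtain ⟨i, hi⟩ := hx
    rw [ha i hi, hb i hi]
    exact h i
  · rw [ha0 (not_exists.1 hx), abs_zero]
    exact abs_nonneg _

theorem rho_step_ne_zero {a : ι → ℝ} (ha : a ≠ 0) : X.rho (step B a) ≠ 0 := by
  intro h0
  obtain ⟨i, hi⟩ := Function.ne_iff.1 ha
  have habs : X.rho (step B fun i => |a i|) = 0 :=
    le_antisymm ((X.rho_step_le_of_abs_le B fun i => (abs_abs (a i)).le).trans h0.le) zero_le
  exact hi (abs_eq_zero.1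
    (step_eq_zero B _ (fun i => abs_nonneg (a i)) (X.rho_eq_zero _ habs) i))

/-- The norm of `∑ i, a i • χ_{B i}` in `X`, as a function of the coefficients. -/
noncomputable def coeffNorm : Seminorm ℝ (ι → ℝ) :=
  Seminorm.of (fun a => (X.rho (step B a)).toReal)
    (fun a b => by
      have ha := (X.rho_step_lt_top B a).ne
      have hb := (X.rho_step_lt_top B b).ne
      rw [← ENNReal.toReal_add ha hb, show a + b = fun i => a i + b i from rfl, step_add]
      exact ENNReal.toReal_mono (ENNReal.add_ne_top.2 ⟨ha, hb⟩) (X.rho_add _ _))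
    (fun r a => by
      rw [show r • a = fun i => r * a i from rfl, step_mul, X.rho_smul, ENNReal.toReal_mul,
        toReal_enorm])

theorem ofReal_coeffNorm (a : ι → ℝ) : ENNReal.ofReal (X.coeffNorm B a) = X.rho (step B a) :=
  ENNReal.ofReal_toReal (X.rho_step_lt_top B a).ne

variable {X B}

theorem isSymmetricNorm_coeffNorm
    (h : ∀ (a : ι → ℝ) (σ : Equiv.Perm ι), X.rho (step B (a ∘ σ)) = X.rho (step B a)) :
    IsSymmetricNorm (X.coeffNorm B) where
  pos a ha := ENNReal.toReal_pos (X.rho_step_ne_zero B ha) (X.rho_step_lt_top B a).ne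
  mono _ b hab := ENNReal.toReal_mono (X.rho_step_lt_top B b).ne (X.rho_step_le_of_abs_le B hab)
  comp_perm a σ := congrArg ENNReal.toReal (h a σ)

variable {H : Type*} [NormedAddCommGroup H] [InnerProductSpace ℝ H]

theorem exists_isFlinnForm_of_isFlinn (hN : IsSymmetricNorm (X.coeffNorm B))
    {u : X.BlockSpace B H} (hu : IsFlinn u) :
    ∃ F : (ι → H) →ₗ[ℝ] ℝ, F ≠ 0 ∧ IsFlinnForm (X.coeffNorm B) u F := by
  obtain ⟨f, hf0, hf⟩ := hu
  refine ⟨f.toLinearMap, fun h => hf0 (ContinuousLinearMap.coe_injective h),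
    fun a c hac s hs => ?_⟩
  let ψ : X.BlockSpace B H →ₗ[ℝ] ℝ := weightedInner c s
  let φ : X.BlockSpace B H →L[ℝ] ℝ := ψ.mkContinuous 1 fun v =>
    (hN.abs_weightedInner_le hac hs v).trans_eq (one_mul ‖v‖).symm
  let x : X.BlockSpace B H := a • s
  have hφ : ‖φ‖ ≤ 1 := ψ.mkContinuous_norm_le zero_le_one _
  have hx : ‖x‖ ≤ φ x := by
    refine (hN.mono _ _ fun i => ?_).trans_eq (hac.weightedInner_smul hs).symm
    rw [abs_norm, show x i = a i • s i from rfl, norm_smul, hs, mul_one, Real.norm_eq_abs]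
  refine hf x φ (le_antisymm ?_ ?_)
  · rw [mul_comm]
    exact (le_abs_self _).trans (φ.le_opNorm x)
  · exact (mul_le_of_le_one_right (norm_nonneg x) hφ).trans hx

end BlockSpace

end KotheSpace

section Lp

variable {Ω : Type*} [MeasurableSpace Ω] {μ : Measure Ω}

theorem memLp_indicator_spanningSets_inter_abs_le [SigmaFinite μ] (p : ℝ≥0∞) (f : Ω →ₘ[μ] ℝ)
    (n : ℕ) : MemLp ((spanningSets μ n ∩ {x | |f x| ≤ n}).indicator f) p μ := by
  have hfin : IsFiniteMeasure (μ.restrict (spanningSets μ n ∩ {x | |f x| ≤ n})) := ⟨by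
    rw [Measure.restrict_apply_univ]
    exact (measure_mono Set.inter_subset_left).trans_lt (measure_spanningSets_lt_top μ n)⟩
  have hmeas : MeasurableSet (spanningSets μ n ∩ {x | |f x| ≤ n}) :=
    (measurableSet_spanningSets μ n).inter (measurableSet_le f.measurable.abs measurable_const)
  rw [memLp_indicator_iff_restrict hmeas]
  refine MemLp.of_bound f.stronglyMeasurable.aestronglyMeasurable n ?_
  filter_upwards [ae_restrict_mem hmeas] with x hx
  exact hx.2

theorem eLpNorm_le_of_forall_abs_le [SigmaFinite μ] {p C : ℝ≥0∞} {f : Ω →ₘ[μ] ℝ}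
    (h : ∀ φ : Lp ℝ p μ, (∀ᵐ x ∂μ, |φ x| ≤ |f x|) → ‖φ‖ₑ ≤ C) : eLpNorm f p μ ≤ C := by
  let g : ℕ → Ω → ℝ := fun n => (spanningSets μ n ∩ {x | |f x| ≤ n}).indicator f
  have hg (n : ℕ) : MemLp (g n) p μ := memLp_indicator_spanningSets_inter_abs_le p f n
  have hgC (n : ℕ) : eLpNorm (g n) p μ ≤ C := by
    rw [← Lp.enorm_toLp (hg n)]
    refine h _ ?_
    filter_upwards [(hg n).coeFn_toLp] with x hx
    rw [hx]
    exact norm_indicator_le_norm_self f x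
  have hlim (x : Ω) : Tendsto (fun n => g n x) atTop (nhds (f x)) := by
    refine tendsto_const_nhds.congr' ?_
    obtain ⟨m, hm⟩ := exists_nat_ge |f x|
    filter_upwards [eventually_ge_atTop m, eventually_ge_atTop (spanningSetsIndex μ x)]
      with n hmn hn
    have hx : x ∈ spanningSets μ n ∩ {x | |f x| ≤ n} :=
      ⟨monotone_spanningSets μ hn (mem_spanningSetsIndex μ x), hm.trans (Nat.cast_le.2 hmn)⟩
    exact (Set.indicator_of_mem hx f).symm
  calc eLpNorm f p μ ≤ liminf (fun n => eLpNorm (g n) p μ) atTop :=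
        Lp.eLpNorm_lim_le_liminf_eLpNorm (fun n => (hg n).1) f (.of_forall hlim)
    _ ≤ C := liminf_le_of_le isBounded_ge_of_bot fun b hb =>
        let ⟨n, hn⟩ := hb.exists
        hn.trans (hgC n)

theorem lintegral_enorm_mul_enorm_le {f g : Ω → ℝ} (hf : AEMeasurable f μ)
    (hg : AEMeasurable g μ) :
    ∫⁻ x, ‖f x‖ₑ * ‖g x‖ₑ ∂μ ≤ eLpNorm f 2 μ * eLpNorm g 2 μ := by
  have h := ENNReal.lintegral_mul_le_Lp_mul_Lq μ Real.HolderConjugate.two_two hf.enorm hg.enorm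
  rwa [eLpNorm_eq_lintegral_rpow_enorm_toReal two_ne_zero ENNReal.ofNat_ne_top,
    eLpNorm_eq_lintegral_rpow_enorm_toReal two_ne_zero ENNReal.ofNat_ne_top]

end Lp

namespace KotheSpace

section Norming

variable {Ω : Type*} [MeasurableSpace Ω] {μ : Measure Ω} {X : KotheSpace μ}

theorem lintegral_enorm_smul_mul (c : ℝ) (f g : Ω →ₘ[μ] ℝ) :
    ∫⁻ x, ‖(c • f) x‖ₑ * ‖g x‖ₑ ∂μ = ‖c‖ₑ * ∫⁻ x, ‖f x‖ₑ * ‖g x‖ₑ ∂μ := by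
  rw [← lintegral_const_mul' _ _ enorm_ne_top]
  refine lintegral_congr_ae ?_
  filter_upwards [AEEqFun.coeFn_smul c f] with x hx
  rw [hx, Pi.smul_apply, smul_eq_mul, enorm_mul, mul_assoc]

theorem lintegral_enorm_mul_le_rho {g : Ω →ₘ[μ] ℝ} (hg : X.dualRho g ≤ 1) (f : Ω →ₘ[μ] ℝ) :
    ∫⁻ x, ‖f x‖ₑ * ‖g x‖ₑ ∂μ ≤ X.rho f := by
  rcases eq_or_ne (X.rho f) 0 with h0 | h0
  · rw [X.rho_eq_zero f h0, ← zero_smul ℝ 0, lintegral_enorm_smul_mul, enorm_zero, zero_mul]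
    exact zero_le
  rcases eq_or_ne (X.rho f) ∞ with htop | htop
  · exact htop ▸ le_top
  obtain ⟨c, hc⟩ : ∃ c : ℝ, ‖c‖ₑ = (X.rho f)⁻¹ :=
    ⟨(X.rho f)⁻¹.toReal, by
      rw [Real.enorm_of_nonneg ENNReal.toReal_nonneg,
        ENNReal.ofReal_toReal (ENNReal.inv_ne_top.2 h0)]⟩
  have hcf : X.rho (c • f) ≤ 1 := by rw [X.rho_smul, hc, ENNReal.inv_mul_cancel h0 htop]
  have hle : ∫⁻ x, ‖(c • f) x‖ₑ * ‖g x‖ₑ ∂μ ≤ 1 :=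
    (le_iSup₂_of_le (c • f) hcf le_rfl).trans hg
  rwa [lintegral_enorm_smul_mul, hc, mul_comm, ← div_eq_mul_inv,
    ENNReal.div_le_iff h0 htop, one_mul] at hle

/-- `X'` is a norming subspace of `X*`. -/
def IsNorming (X : KotheSpace μ) : Prop :=
  ∀ f, X.rho f < ∞ →
    X.rho f = ⨆ (g : Ω →ₘ[μ] ℝ) (_ : X.dualRho g ≤ 1), ‖∫ x, f x * g x ∂μ‖ₑ

theorem norm_le_one_of_abs_le (hd : Dense {φ : Lp ℝ 2 μ | X.rho φ = ‖φ‖ₑ}) {g : Ω →ₘ[μ] ℝ}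
    (hg : X.dualRho g ≤ 1) {φ : Lp ℝ 2 μ} (hφ : ∀ᵐ x ∂μ, |φ x| ≤ |g x|) : ‖φ‖ ≤ 1 := by
  have hdense : ∀ h : Lp ℝ 2 μ, X.rho h = ‖h‖ₑ → inner ℝ h φ ≤ ‖h‖ := by
    intro h hh
    have hle : ‖inner ℝ h φ‖ₑ ≤ ‖h‖ₑ := by
      calc ‖inner ℝ h φ‖ₑ = ‖∫ x, h x * φ x ∂μ‖ₑ := by
            simp only [L2.inner_def, RCLike.inner_apply, conj_trivial, mul_comm]
        _ ≤ ∫⁻ x, ‖h x * φ x‖ₑ ∂μ := enorm_integral_le_lintegral_enorm _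
        _ ≤ ∫⁻ x, ‖h x‖ₑ * ‖g x‖ₑ ∂μ := by
            refine lintegral_mono_ae ?_
            filter_upwards [hφ] with x hx
            rw [enorm_mul]
            gcongr
            exact enorm_le_iff_norm_le.2 hx
        _ ≤ ‖h‖ₑ := (lintegral_enorm_mul_le_rho hg h).trans_eq hh
    exact (le_abs_self _).trans (enorm_le_iff_norm_le.1 hle)
  have hclosed : IsClosed {h : Lp ℝ 2 μ | inner ℝ h φ ≤ ‖h‖} :=
    isClosed_le (by fun_prop) continuous_norm
  have hself : ‖φ‖ * ‖φ‖ ≤ ‖φ‖ :=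
    (real_inner_self_eq_norm_mul_norm φ).symm.trans_le (closure_minimal hdense hclosed (hd φ))
  by_contra! hlt
  exact (lt_mul_of_one_lt_left (zero_lt_one.trans hlt) hlt).not_ge hself

variable [SigmaFinite μ]

theorem IsNorming.rho_le_eLpNorm_two (hX : X.IsNorming) (hd : Dense {φ : Lp ℝ 2 μ | X.rho φ = ‖φ‖ₑ})
    {f : Ω →ₘ[μ] ℝ} (hf : X.rho f < ∞) : X.rho f ≤ eLpNorm f 2 μ := by
  rw [hX f hf]
  refine iSup₂_le fun g hg => ?_
  have hg2 : eLpNorm g 2 μ ≤ 1 := eLpNorm_le_of_forall_abs_le fun φ hφ => by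
    rw [← ofReal_norm]
    exact ENNReal.ofReal_le_one.2 (norm_le_one_of_abs_le hd hg hφ)
  calc ‖∫ x, f x * g x ∂μ‖ₑ ≤ ∫⁻ x, ‖f x * g x‖ₑ ∂μ := enorm_integral_le_lintegral_enorm _
    _ = ∫⁻ x, ‖f x‖ₑ * ‖g x‖ₑ ∂μ := by simp only [enorm_mul]
    _ ≤ eLpNorm f 2 μ * eLpNorm g 2 μ :=
        lintegral_enorm_mul_enorm_le f.measurable.aemeasurable g.measurable.aemeasurable
    _ ≤ eLpNorm f 2 μ := mul_le_of_le_one_right' hg2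

theorem IsNorming.enorm_le_rho (hX : X.IsNorming) (hd : Dense {φ : Lp ℝ 2 μ | X.rho φ = ‖φ‖ₑ})
    (φ : Lp ℝ 2 μ) : ‖φ‖ₑ ≤ X.rho φ := by
  rcases eq_top_or_lt_top (X.rho φ) with htop | hfin
  · exact htop ▸ le_top
  have hdense : ∀ h : Lp ℝ 2 μ, X.rho h = ‖h‖ₑ → ‖h‖ₑ ≤ X.rho φ + ‖h - φ‖ₑ := by
    intro h hh
    have hneg : X.rho (-φ : Ω →ₘ[μ] ℝ) = X.rho φ := by
      simpa using X.rho_smul (-1) (φ : Ω →ₘ[μ] ℝ)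
    have hsub : X.rho (h - φ : Ω →ₘ[μ] ℝ) < ∞ := by
      rw [sub_eq_add_neg]
      refine (X.rho_add _ _).trans_lt (ENNReal.add_lt_top.2 ⟨?_, hneg ▸ hfin⟩)
      exact hh ▸ enorm_lt_top
    calc ‖h‖ₑ = X.rho (φ + (h - φ) : Ω →ₘ[μ] ℝ) := by rw [add_sub_cancel, hh]
      _ ≤ X.rho φ + X.rho (h - φ : Ω →ₘ[μ] ℝ) := X.rho_add _ _
      _ ≤ X.rho φ + ‖h - φ‖ₑ := by
          gcongr
          exact (hX.rho_le_eLpNorm_two hd hsub).trans_eq (Lp.enorm_def (h - φ)).symm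
  have hclosed : IsClosed {h : Lp ℝ 2 μ | ‖h‖ₑ ≤ X.rho φ + ‖h - φ‖ₑ} :=
    isClosed_le continuous_enorm (by fun_prop)
  have hself : ‖φ‖ₑ ≤ X.rho φ + ‖φ - φ‖ₑ := closure_minimal hdense hclosed (hd φ)
  rwa [sub_self, enorm_zero, add_zero] at hself

theorem IsNorming.proportionalToLp_two (hX : X.IsNorming)
    (hd : Dense {φ : Lp ℝ 2 μ | X.rho φ = ‖φ‖ₑ}) : X.ProportionalToLp 2 := by
  refine ⟨1, fun f hf => ?_⟩
  rw [ENNReal.coe_one, one_mul]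
  exact (hX.rho_le_eLpNorm_two hd hf).antisymm <| eLpNorm_le_of_forall_abs_le fun φ hφ =>
    (hX.enorm_le_rho hd φ).trans (X.rho_mono _ f hφ)

end Norming

end KotheSpace

namespace Blocks

variable {Ω : Type*} [MeasurableSpace Ω] {μ : Measure Ω}

/-- Any two of the blocks can be interchanged, up to null sets, by an invertible
measure-preserving map that respects all the other blocks. -/
def IsExchangeable {ι : Type*} [DecidableEq ι] (B : Blocks μ ι) : Prop :=
  ∀ k l, ∃ τ : Ω ≃ᵐ Ω, MeasurePreserving τ μ μ ∧
    ∀ᵐ x ∂μ, ∀ i, τ x ∈ B.set (Equiv.swap k l i) ↔ x ∈ B.set i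

theorem IsExchangeable.measure_eq {ι : Type*} [DecidableEq ι] {B : Blocks μ ι}
    (hB : B.IsExchangeable) (i j : ι) : μ (B.set i) = μ (B.set j) := by
  obtain ⟨τ, hτ, hswap⟩ := hB i j
  rw [← hτ.measure_preimage (B.measurable j).nullMeasurableSet]
  refine measure_congr ?_
  filter_upwards [hswap] with x hx
  have hxi := hx i
  rw [Equiv.swap_apply_left] at hxi
  exact propext hxi.symm

/-- The step functions over the `n`-th system of blocks approximate any given function in `L_2`
arbitrarily well as `n` grows. -/
def IsExhausting {ι : ℕ → Type*} [∀ n, Fintype (ι n)] (B : ∀ n, Blocks μ (ι n)) : Prop :=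
  ∀ f : Ω → ℝ, MemLp f 2 μ → ∀ ε : ℝ≥0∞, ε ≠ 0 →
    ∀ᶠ n in atTop, ∃ a, eLpNorm (f - (KotheSpace.step (B n) a : Ω → ℝ)) 2 μ ≤ ε

end Blocks

namespace KotheSpace

section Exchangeable

variable {Ω : Type*} [MeasurableSpace Ω] {μ : Measure Ω} {X : KotheSpace μ}

section Step

variable {ι : Type*} [Fintype ι] {B : Blocks μ ι}

theorem eLpNorm_step_two_sq (B : Blocks μ ι) (a : ι → ℝ) :
    eLpNorm (step B a) 2 μ ^ 2 = ∑ i, ‖a i‖ₑ ^ 2 * μ (B.set i) := by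
  have hstep : ∀ᵐ x ∂μ, ‖step B a x‖ₑ ^ 2
      = ∑ i, (B.set i).indicator (fun _ => ‖a i‖ₑ ^ 2) x := by
    filter_upwards [step_ae_eq_of_mem B a, step_ae_eq_zero B a] with x hmem hzero
    by_cases hx : ∃ i, x ∈ B.set i
    · obtain ⟨i, hi⟩ := hx
      rw [hmem i hi, Finset.sum_eq_single i, Set.indicator_of_mem hi]
      · exact fun j _ hj => Set.indicator_of_notMem (mt (B.mem_set_iff_eq hi j).1 hj) _
      · simp
    · rw [not_exists] at hx
      simp [hzero hx, hx]
  have hpow := eLpNorm_nnreal_pow_eq_lintegral (f := step B a) (μ := μ) (two_ne_zero (α := ℝ≥0))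
  simp only [NNReal.coe_ofNat, ENNReal.coe_ofNat, ENNReal.rpow_ofNat] at hpow
  rw [hpow, lintegral_congr_ae hstep,
    lintegral_finsetSum _ fun i _ => measurable_const.indicator (B.measurable i)]
  simp only [lintegral_indicator_const (B.measurable _)]

theorem eLpNorm_step_two_mul_enorm (hB : ∀ i j, μ (B.set i) = μ (B.set j)) (a b : ι → ℝ) :
    eLpNorm (step B a) 2 μ * ‖WithLp.toLp 2 b‖ₑ = eLpNorm (step B b) 2 μ * ‖WithLp.toLp 2 a‖ₑ := by
  have hsq (c : ι → ℝ) : ‖WithLp.toLp 2 c‖ₑ ^ 2 = ∑ i, ‖c i‖ₑ ^ 2 := by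
    rw [← ofReal_norm, ← ENNReal.ofReal_pow (norm_nonneg _), EuclideanSpace.norm_sq_eq,
      ENNReal.ofReal_sum_of_nonneg fun i _ => sq_nonneg _]
    simp only [ENNReal.ofReal_pow (norm_nonneg _), ofReal_norm]
  apply (ENNReal.pow_right_strictMono two_ne_zero).injective
  simp only [mul_pow, eLpNorm_step_two_sq, hsq]
  rcases isEmpty_or_nonempty ι with _ | ⟨⟨i⟩⟩
  · simp
  · simp only [hB _ i, ← Finset.sum_mul]
    ring

theorem step_indicator (B : Blocks μ ι) (I : Finset ι) :
    step B ((I : Set ι).indicator 1) = chi μ (⋃ i ∈ I, B.set i)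
      (I.measurableSet_biUnion fun i _ => B.measurable i) := by
  apply AEEqFun.ext
  filter_upwards [step_ae_eq_of_mem B ((I : Set ι).indicator 1),
    step_ae_eq_zero B ((I : Set ι).indicator 1),
    AEEqFun.coeFn_mk ((⋃ i ∈ I, B.set i).indicator fun _ => (1 : ℝ)) _] with x hmem hzero hchi
  rw [chi, hchi]
  by_cases hx : ∃ i, x ∈ B.set i
  · obtain ⟨i, hi⟩ := hx
    have hI : x ∈ ⋃ j ∈ I, B.set j ↔ i ∈ I := by simp [B.mem_set_iff_eq hi]
    rw [hmem i hi]
    by_cases h : i ∈ I <;> simp [h, hI]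
  · rw [not_exists] at hx
    simp [hzero hx, hx]

theorem IsRI.rho_chi_eq (hX : X.IsRI) {A : Set Ω} (hA : MeasurableSet A) (h : μ A = 1) :
    X.rho (chi μ A hA) = eLpNorm (chi μ A hA) 2 μ := by
  rw [hX.normalized A hA h, chi, eLpNorm_congr_ae (AEEqFun.coeFn_mk _ _),
    eLpNorm_indicator_const hA two_ne_zero ENNReal.ofNat_ne_top, h]
  simp

theorem compMeasurePreserving_step {τ : Ω → Ω} (hτ : MeasurePreserving τ μ μ)
    (σ : Equiv.Perm ι) (h : ∀ᵐ x ∂μ, ∀ i, τ x ∈ B.set (σ i) ↔ x ∈ B.set i) (a : ι → ℝ) :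
    (step B a).compMeasurePreserving τ hτ = step B (a ∘ σ) := by
  apply AEEqFun.ext
  filter_upwards [AEEqFun.coeFn_compMeasurePreserving (step B a) hτ, step_coeFn B (a ∘ σ),
    hτ.quasiMeasurePreserving.ae (step_coeFn B a), h] with x hcomp hσ ha hx
  rw [hcomp, hσ, Function.comp_apply, ha, ← Equiv.sum_comp σ]
  refine Finset.sum_congr rfl fun i _ => ?_
  by_cases hi : x ∈ B.set i <;> simp [hi, hx i]

variable {H : Type*} [NormedAddCommGroup H] [InnerProductSpace ℝ H]

theorem nonempty_of_isFlinn {u : X.BlockSpace B H} (hu : IsFlinn u) : Nonempty ι := by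
  by_contra hempty
  rw [not_nonempty_iff] at hempty
  obtain ⟨f, hf, -⟩ := hu
  refine hf (ContinuousLinearMap.ext fun v => ?_)
  rw [show v = 0 from funext isEmptyElim, map_zero, map_zero]

section IsExchangeable

variable [DecidableEq ι]

theorem IsRI.isSymmetricNorm_coeffNorm (hX : X.IsRI) (hB : B.IsExchangeable) :
    IsSymmetricNorm (X.coeffNorm B) := by
  refine KotheSpace.isSymmetricNorm_coeffNorm fun a σ => ?_
  induction σ using Equiv.Perm.swap_induction_on generalizing a with
  | one => rfl
  | swap_mul f k l _ ih =>
    obtain ⟨τ, hτ, hswap⟩ := hB k l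
    rw [Equiv.Perm.coe_mul, ← Function.comp_assoc, ih, ← compMeasurePreserving_step hτ _ hswap,
      hX.invariant τ hτ]

theorem IsRI.rho_step_mul_enorm (hX : X.IsRI) (hB : B.IsExchangeable)
    (hH : 1 < Module.rank ℝ H) {u : X.BlockSpace B H} (hu : IsFlinn u) {i j : ι} (hij : i ≠ j)
    (hi : u i ≠ 0) (hj : u j ≠ 0) (a b : ι → ℝ) :
    X.rho (step B a) * ‖WithLp.toLp 2 b‖ₑ = X.rho (step B b) * ‖WithLp.toLp 2 a‖ₑ := by
  have hN := hX.isSymmetricNorm_coeffNorm hB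
  obtain ⟨F, hF0, hF⟩ := exists_isFlinnForm_of_isFlinn hN hu
  rw [← ofReal_coeffNorm, ← ofReal_coeffNorm, ← ofReal_norm, ← ofReal_norm,
    ← ENNReal.ofReal_mul (apply_nonneg _ _), ← ENNReal.ofReal_mul (apply_nonneg _ _),
    hF.mul_norm_eq_mul_norm hN hH hF0 hij hi hj]

theorem IsRI.rho_step_eq_eLpNorm_two (hX : X.IsRI) (hB : B.IsExchangeable)
    (hone : ∀ i, ∃ I : Finset ι, i ∈ I ∧ μ (⋃ j ∈ I, B.set j) = 1)
    (hH : 1 < Module.rank ℝ H) {u : X.BlockSpace B H} (hu : IsFlinn u) {i j : ι} (hij : i ≠ j)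
    (hi : u i ≠ 0) (hj : u j ≠ 0) (a : ι → ℝ) :
    X.rho (step B a) = eLpNorm (step B a) 2 μ := by
  obtain ⟨I, hiI, hI⟩ := hone i
  let b : ι → ℝ := (I : Set ι).indicator 1
  have hb : WithLp.toLp 2 b ≠ 0 := fun h => by
    simpa [b, hiI] using congrFun (congrArg WithLp.ofLp h) i
  have hrho : X.rho (step B b) = eLpNorm (step B b) 2 μ := by
    rw [step_indicator]
    exact hX.rho_chi_eq _ hI
  refine (ENNReal.mul_left_inj (enorm_ne_zero.2 hb) enorm_ne_top).1 ?_
  rw [hX.rho_step_mul_enorm hB hH hu hij hi hj a b, hrho,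
    eLpNorm_step_two_mul_enorm hB.measure_eq a b]

end IsExchangeable

end Step

variable {ι : ℕ → Type*} [∀ n, Fintype (ι n)] {B : ∀ n, Blocks μ (ι n)}

theorem dense_rho_eq_enorm_of_isExhausting (hB : Blocks.IsExhausting B)
    (h : ∃ᶠ n in atTop, ∀ a, X.rho (step (B n) a) = eLpNorm (step (B n) a) 2 μ) :
    Dense {φ : Lp ℝ 2 μ | X.rho φ = ‖φ‖ₑ} := by
  refine fun φ => EMetric.mem_closure_iff.2 fun ε hε => ?_
  obtain ⟨δ, hδ, hδε⟩ := exists_between hε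
  obtain ⟨n, hn, a, ha⟩ := (h.and_eventually (hB φ (Lp.memLp φ) δ hδ.ne')).exists
  have hstep : MemLp (step (B n) a) 2 μ := by
    refine ⟨(step (B n) a).aestronglyMeasurable, ?_⟩
    rw [← hn]
    exact X.rho_step_lt_top (B n) a
  let ψ : Lp ℝ 2 μ := ⟨step (B n) a, hstep.2⟩
  have hψ : X.rho ψ = ‖ψ‖ₑ := by
    rw [Lp.enorm_def]
    exact hn a
  refine ⟨ψ, hψ, ?_⟩
  rw [Lp.edist_def]
  exact ha.trans_lt hδε

theorem IsRI.eventually_forall_isFlinn [SigmaFinite μ] [∀ n, DecidableEq (ι n)]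
    {H : Type*} [NormedAddCommGroup H] [InnerProductSpace ℝ H] (hX : X.IsRI)
    (hX2 : ¬ X.ProportionalToLp 2) (hH : 1 < Module.rank ℝ H)
    (hB : ∀ n, (B n).IsExchangeable) (hBe : Blocks.IsExhausting B)
    (hone : ∀ n i, ∃ I : Finset (ι n), i ∈ I ∧ μ (⋃ j ∈ I, (B n).set j) = 1) :
    ∀ᶠ n in atTop, ∀ u : X.BlockSpace (B n) H, IsFlinn u → ∃ i₀, ∀ i, i ≠ i₀ → u i = 0 := by
  by_contra hbad
  refine hX2 (IsNorming.proportionalToLp_two hX.norming (dense_rho_eq_enorm_of_isExhausting hBe ?_))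
  refine (not_eventually.1 hbad).mono fun n hn => ?_
  obtain ⟨u, hu, hsupp⟩ : ∃ u : X.BlockSpace (B n) H, IsFlinn u ∧ ∀ i₀, ∃ i, i ≠ i₀ ∧ u i ≠ 0 := by
    simpa using hn
  obtain ⟨k⟩ := nonempty_of_isFlinn hu
  obtain ⟨i, -, hi⟩ := hsupp k
  obtain ⟨j, hji, hj⟩ := hsupp i
  exact hX.rho_step_eq_eLpNorm_two (hB n) (hone n) hH hu hji.symm hi hj

end Exchangeable

end KotheSpace

theorem involutive_piecewise {α : Type*} {f g : α → α} {s : Set α} [∀ x, Decidable (x ∈ s)]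
    (hf : Function.Involutive f) (hg : Function.Involutive g) (hfs : f ⁻¹' s = s)
    (hgs : g ⁻¹' s = s) : Function.Involutive (s.piecewise f g) := by
  intro x
  by_cases hx : x ∈ s
  · have hfx : f x ∈ s := hfs.ge hx
    rw [Set.piecewise_eq_of_mem _ _ _ hx, Set.piecewise_eq_of_mem _ _ _ hfx, hf x]
  · have hgx : g x ∉ s := fun h => hx (hgs.le h)
    rw [Set.piecewise_eq_of_notMem _ _ _ hx, Set.piecewise_eq_of_notMem _ _ _ hgx, hg x]

section MeasurePreserving

variable {α β : Type*} [MeasurableSpace α] [MeasurableSpace β] {μ : Measure α} {ν : Measure β}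

theorem measurePreserving_count {f : α → β} (hf : Measurable f)
    (hbij : Function.Bijective f) : MeasurePreserving f Measure.count Measure.count := by
  refine ⟨hf, Measure.ext fun s hs => ?_⟩
  rw [Measure.map_apply hf hs, Measure.count_apply hs, Measure.count_apply (hf hs),
    Set.encard_preimage_of_bijective hbij]

theorem measurePreserving_piecewise {f g : α → β}
    {s : Set α} {t : Set β} [∀ x, Decidable (x ∈ s)] (hf : MeasurePreserving f μ ν)
    (hg : MeasurePreserving g μ ν) (ht : MeasurableSet t) (hft : f ⁻¹' t = s) (hgt : g ⁻¹' t = s) :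
    MeasurePreserving (s.piecewise f g) μ ν := by
  have hs : MeasurableSet s := hft ▸ hf.measurable ht
  have hm : Measurable (s.piecewise f g) := hf.measurable.piecewise hs hg.measurable
  refine ⟨hm, Measure.ext fun u hu => ?_⟩
  have hinter : s.piecewise f g ⁻¹' u ∩ s = f ⁻¹' (u ∩ t) := by
    rw [Set.piecewise_preimage, Set.ite_inter_self, Set.preimage_inter, hft]
  have hdiff : s.piecewise f g ⁻¹' u \ s = g ⁻¹' (u \ t) := by
    rw [Set.piecewise_preimage, Set.ite_sdiff_self, Set.preimage_sdiff, hgt]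
  rw [Measure.map_apply hm hu, ← measure_inter_add_sdiff _ hs, hinter, hdiff,
    hf.measure_preimage (hu.inter ht).nullMeasurableSet,
    hg.measure_preimage (hu.diff ht).nullMeasurableSet, measure_inter_add_sdiff _ ht]

theorem measurePreserving_mapsTo_restrict {f : α → β} {s : Set α} {t : Set β}
    (hf : MeasurePreserving f μ ν) (hs : MeasurableSet s) (ht : MeasurableSet t)
    (hst : f ⁻¹' t = s) :
    MeasurePreserving (Set.MapsTo.restrict f s t hst.ge) (μ.comap (↑)) (ν.comap (↑)) := by
  have hm : Measurable (Set.MapsTo.restrict f s t hst.ge) :=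
    (hf.measurable.comp measurable_subtype_coe).subtype_mk
  refine ⟨hm, (MeasurableEmbedding.subtype_coe ht).map_injective ?_⟩
  have hcoe : ((↑) : t → β) ∘ Set.MapsTo.restrict f s t hst.ge = f ∘ ((↑) : s → α) := rfl
  rw [Measure.map_map measurable_subtype_coe hm, hcoe,
    ← Measure.map_map hf.measurable measurable_subtype_coe, map_comap_subtype_coe hs,
    map_comap_subtype_coe ht, ← hst, (hf.restrict_preimage ht).map_eq]

theorem exists_measurePreserving_reflection {s : Set ℝ} {c : ℝ} (hs : MeasurableSet s)
    (hsub : s ⊆ unitInterval) (hc : (fun y => c - y) ⁻¹' s = s) :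
    ∃ τ : unitInterval ≃ᵐ unitInterval, MeasurePreserving τ volume volume ∧
      (∀ x : unitInterval, (x : ℝ) ∈ s → (τ x : ℝ) = c - x) ∧
      ∀ x : unitInterval, (x : ℝ) ∉ s → τ x = x := by
  classical
  let f : ℝ → ℝ := s.piecewise (fun y => c - y) id
  have hmem : ∀ y ∈ s, f y = c - y := fun _ => Set.piecewise_eq_of_mem _ _ _
  have hnotMem : ∀ y ∉ s, f y = y := fun _ => Set.piecewise_eq_of_notMem _ _ _
  have hinv : Function.Involutive f :=
    involutive_piecewise (fun y => sub_sub_cancel c y) (fun _ => rfl) hc rfl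
  have hf : MeasurePreserving f volume volume :=
    measurePreserving_piecewise (Measure.measurePreserving_sub_left volume c) (.id _) hs hc rfl
  have hmaps : Set.MapsTo f unitInterval unitInterval := by
    intro y hy
    by_cases hys : y ∈ s
    · exact (hmem y hys).symm ▸ hsub (hc.ge hys)
    · exact (hnotMem y hys).symm ▸ hy
  have hpre : f ⁻¹' unitInterval = unitInterval :=
    Set.Subset.antisymm (fun y hy => hinv y ▸ hmaps hy) hmaps
  have hτ := measurePreserving_mapsTo_restrict hf measurableSet_Icc measurableSet_Icc hpre
  exact ⟨.ofInvolutive _ (fun x => Subtype.ext (hinv x)) hτ.measurable, hτ,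
    fun x => hmem x, fun x hx => Subtype.ext (hnotMem x hx)⟩

end MeasurePreserving

namespace Blocks

section Count

variable {α : Type*} [MeasurableSpace α] [DiscreteMeasurableSpace α]

theorem isExchangeable_of_set_eq_singleton {ι : Type*} [DecidableEq ι]
    {B : Blocks (Measure.count : Measure α) ι} (e : ι ↪ α) (he : ∀ i, B.set i = {e i}) :
    B.IsExchangeable := by
  classical
  refine fun k l => ⟨.ofInvolutive (Equiv.swap (e k) (e l)) (fun x => Equiv.swap_apply_self _ _ x)
    .of_discrete, measurePreserving_count .of_discrete (Equiv.bijective _),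
    .of_forall fun x i => ?_⟩
  change Equiv.swap (e k) (e l) x ∈ _ ↔ _
  rw [he, he, Set.mem_singleton_iff, Set.mem_singleton_iff, ← e.injective.swap_apply,
    (Equiv.injective _).eq_iff]

theorem isExhausting_of_set_eq_singleton {ι : ℕ → Type*} [∀ n, Fintype (ι n)]
    {B : ∀ n, Blocks (Measure.count : Measure α) (ι n)} (e : ∀ n, ι n → α)
    (he : ∀ n i, (B n).set i = {e n i}) (hcover : ∀ x, ∀ᶠ n in atTop, x ∈ Set.range (e n)) :
    IsExhausting B := by
  intro f hf ε hε
  obtain ⟨s, -, hs, hsε⟩ := hf.exists_eLpNorm_indicator_compl_lt ENNReal.ofNat_ne_top hε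
  rw [Measure.count_apply_lt_top] at hs
  filter_upwards [(eventually_all_finite hs).2 fun x _ => hcover x] with n hn
  refine ⟨f ∘ e n, (eLpNorm_mono_ae ?_).trans hsε.le⟩
  filter_upwards [KotheSpace.step_ae_eq_of_mem (B n) (f ∘ e n),
    KotheSpace.step_ae_eq_zero (B n) (f ∘ e n)] with x hmem hzero
  rw [Pi.sub_apply]
  by_cases hx : ∃ i, x = e n i
  · obtain ⟨i, rfl⟩ := hx
    rw [hmem i (by rw [he, Set.mem_singleton_iff]), Function.comp_apply, sub_self, norm_zero]
    exact norm_nonneg _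
  · have hxs : x ∈ sᶜ := fun h => hx ((hn x h).imp fun _ => Eq.symm)
    rw [not_exists] at hx
    rw [hzero fun i => by rw [he]; exact hx i, sub_zero, Set.indicator_of_mem hxs]

end Count

end Blocks

theorem KotheSpace.IsRI.eventually_forall_isFlinn_count {α : Type*} [MeasurableSpace α]
    [DiscreteMeasurableSpace α] [Countable α] {X : KotheSpace (Measure.count : Measure α)}
    {ι : ℕ → Type*} [∀ n, Fintype (ι n)] {B : ∀ n, Blocks (Measure.count : Measure α) (ι n)}
    {H : Type*} [NormedAddCommGroup H] [InnerProductSpace ℝ H] (hX : X.IsRI)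
    (hX2 : ¬ X.ProportionalToLp 2) (hH : 1 < Module.rank ℝ H) (e : ∀ n, ι n ↪ α)
    (he : ∀ n i, (B n).set i = {e n i}) (hcover : ∀ x, ∀ᶠ n in atTop, x ∈ Set.range (e n)) :
    ∀ᶠ n in atTop, ∀ u : X.BlockSpace (B n) H, IsFlinn u → ∃ i₀, ∀ i, i ≠ i₀ → u i = 0 := by
  classical
  exact hX.eventually_forall_isFlinn hX2 hH
    (fun n => Blocks.isExchangeable_of_set_eq_singleton (e n) (he n))
    (Blocks.isExhausting_of_set_eq_singleton (fun n => e n) he hcover)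
    fun n i => ⟨{i}, Finset.mem_singleton_self i, by simp [he]⟩

section DyadicBlocks

theorem mem_dyadicBlocks {n : ℕ} {i : Fin (2 ^ n)} {x : unitInterval} :
    x ∈ (dyadicBlocks n).set i ↔ (i : ℝ) / 2 ^ n < x ∧ (x : ℝ) ≤ (i : ℝ) / 2 ^ n + 1 / 2 ^ n := by
  rw [← add_div]
  rfl

theorem ae_exists_mem_dyadicBlocks (n : ℕ) :
    ∀ᵐ x : unitInterval, ∃ i, x ∈ (dyadicBlocks n).set i := by
  filter_upwards [Measure.ae_ne volume 0] with x hx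
  have hp : (0 : ℝ) < 2 ^ n := by positivity
  have hpos : 0 < (x : ℝ) * 2 ^ n := mul_pos (unitInterval.pos_iff_ne_zero.2 hx) hp
  obtain ⟨m, hm⟩ := Nat.exists_eq_succ_of_ne_zero (Nat.ceil_pos.2 hpos).ne'
  have hlt : (m : ℝ) < x * 2 ^ n := Nat.lt_ceil.1 (hm ▸ m.lt_succ_self)
  have hle : (x : ℝ) * 2 ^ n ≤ m + 1 := by exact_mod_cast Nat.ceil_le.1 hm.le
  have hm2 : m < 2 ^ n := by exact_mod_cast hlt.trans_le (mul_le_of_le_one_left hp.le x.2.2)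
  exact ⟨⟨m, hm2⟩, (div_lt_iff₀ hp).2 hlt, (le_div_iff₀ hp).2 hle⟩

theorem ae_ne_right_endpoint_dyadicBlocks (n : ℕ) :
    ∀ᵐ x : unitInterval, ∀ i : Fin (2 ^ n), (x : ℝ) ≠ (i : ℝ) / 2 ^ n + 1 / 2 ^ n :=
  ae_all_iff.2 fun _ => ((Set.countable_singleton _).preimage Subtype.val_injective).ae_notMem _

theorem isExchangeable_dyadicBlocks (n : ℕ) : (dyadicBlocks n).IsExchangeable := by
  intro k l
  -- Reflecting the union of two open intervals of equal length in its centre interchanges them.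
  let s : Fin (2 ^ n) → Set ℝ := fun i => Set.Ioo ((i : ℝ) / 2 ^ n) ((i : ℝ) / 2 ^ n + 1 / 2 ^ n)
  have hs (i : Fin (2 ^ n)) : s i ⊆ unitInterval := by
    have hi : (i : ℝ) / 2 ^ n + 1 / 2 ^ n ≤ 1 := by
      rw [← add_div, div_le_one (by positivity)]
      exact_mod_cast i.isLt
    exact fun y hy => ⟨(by positivity : (0 : ℝ) ≤ (i : ℝ) / 2 ^ n).trans hy.1.le, hy.2.le.trans hi⟩
  obtain ⟨τ, hτ, hreflect, hfix⟩ := exists_measurePreserving_reflection (s := s k ∪ s l)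
    (c := (k : ℝ) / 2 ^ n + (l : ℝ) / 2 ^ n + 1 / 2 ^ n) (measurableSet_Ioo.union measurableSet_Ioo)
    (Set.union_subset (hs k) (hs l)) (by
      rw [Set.preimage_union, Set.preimage_const_sub_Ioo, Set.preimage_const_sub_Ioo,
        Set.union_comm]
      congr 2 <;> ring)
  refine ⟨τ, hτ, ?_⟩
  filter_upwards [ae_exists_mem_dyadicBlocks n, ae_ne_right_endpoint_dyadicBlocks n]
    with x ⟨j, hj⟩ hx
  suffices hmem : τ x ∈ (dyadicBlocks n).set (Equiv.swap k l j) by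
    intro i
    rw [Blocks.mem_set_iff_eq _ hmem, Blocks.mem_set_iff_eq _ hj, (Equiv.injective _).eq_iff]
  have hxs {i} (hi : x ∈ (dyadicBlocks n).set i) : (x : ℝ) ∈ s i :=
    ⟨(mem_dyadicBlocks.1 hi).1, (mem_dyadicBlocks.1 hi).2.lt_of_ne (hx i)⟩
  have hsx {i} (hi : (x : ℝ) ∈ s i) : x ∈ (dyadicBlocks n).set i :=
    mem_dyadicBlocks.2 ⟨hi.1, hi.2.le⟩
  have hxj := hxs hj
  rcases eq_or_ne j k with rfl | hjk
  · rw [Equiv.swap_apply_left, mem_dyadicBlocks, hreflect x (.inl hxj)]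
    constructor <;> linarith [hxj.1, hxj.2]
  rcases eq_or_ne j l with rfl | hjl
  · rw [Equiv.swap_apply_right, mem_dyadicBlocks, hreflect x (.inr hxj)]
    constructor <;> linarith [hxj.1, hxj.2]
  · rw [Equiv.swap_apply_of_ne_of_ne hjk hjl, hfix x]
    · exact hj
    · rintro (h | h)
      · exact hjk ((Blocks.mem_set_iff_eq _ (hsx h) j).1 hj)
      · exact hjl ((Blocks.mem_set_iff_eq _ (hsx h) j).1 hj)

theorem volume_iUnion_dyadicBlocks (n : ℕ) :
    volume (⋃ i ∈ (Finset.univ : Finset (Fin (2 ^ n))), (dyadicBlocks n).set i) = 1 := by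
  rw [← prob_compl_eq_zero_iff (Finset.univ.measurableSet_biUnion fun i _ =>
    (dyadicBlocks n).measurable i)]
  simpa [ae_iff, Set.compl_def] using ae_exists_mem_dyadicBlocks n

theorem isExhausting_dyadicBlocks : Blocks.IsExhausting dyadicBlocks := by
  intro f hf ε hε
  obtain ⟨g, hg, -⟩ := hf.exists_boundedContinuous_eLpNorm_sub_le ENNReal.ofNat_ne_top
    (ENNReal.half_pos hε).ne'
  obtain ⟨δ, hδ, hδε⟩ := ENNReal.lt_iff_exists_nnreal_btwn.1 (ENNReal.half_pos hε)
  obtain ⟨η, hη, hgη⟩ := Metric.uniformContinuous_iff.1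
    (CompactSpace.uniformContinuous_of_continuous g.continuous) δ (by exact_mod_cast hδ)
  have hmesh : ∀ᶠ n : ℕ in atTop, (1 / 2 : ℝ) ^ n < η :=
    (tendsto_pow_atTop_nhds_zero_of_lt_one (by norm_num) (by norm_num)).eventually_lt_const hη
  filter_upwards [hmesh] with n hn
  have hy (i : Fin (2 ^ n)) : ((i : ℝ) + 1) / 2 ^ n ∈ unitInterval := by
    refine ⟨by positivity, (div_le_one (by positivity)).2 ?_⟩
    exact_mod_cast i.isLt
  let a : Fin (2 ^ n) → ℝ := fun i => g ⟨((i : ℝ) + 1) / 2 ^ n, hy i⟩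
  have hga : ∀ᵐ x : unitInterval, ‖(⇑g - KotheSpace.step (dyadicBlocks n) a) x‖ ≤ δ := by
    filter_upwards [ae_exists_mem_dyadicBlocks n,
      KotheSpace.step_ae_eq_of_mem (dyadicBlocks n) a] with x ⟨i, hi⟩ hx
    rw [Pi.sub_apply, hx i hi, ← dist_eq_norm]
    refine (hgη ?_).le
    rw [Subtype.dist_eq, Real.dist_eq, abs_sub_comm, abs_of_nonneg (sub_nonneg.2 hi.2)]
    rw [one_div_pow] at hn
    linarith [(mem_dyadicBlocks.1 hi).1, add_div (i : ℝ) 1 (2 ^ n)]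
  refine ⟨a, ?_⟩
  rw [← sub_add_sub_cancel f g, ← ENNReal.add_halves ε]
  have hgm : AEStronglyMeasurable (g : unitInterval → ℝ) volume := g.continuous.aestronglyMeasurable
  refine (eLpNorm_add_le (hf.1.sub hgm) (hgm.sub (AEEqFun.aestronglyMeasurable _))
    one_le_two).trans (add_le_add hg ?_)
  refine (eLpNorm_le_of_ae_bound hga).trans ?_
  simpa using hδε.le

end DyadicBlocks

theorem proposition3p1_general {H : Type*} [NormedAddCommGroup H] [InnerProductSpace ℝ H]
    (hH : 1 < Module.rank ℝ H) :
    (∀ X : KotheSpace (volume : Measure unitInterval), X.IsRI → ¬ X.ProportionalToLp 2 →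
      ∃ N : ℕ, ∀ n ≥ N, ∀ u : X.BlockSpace (dyadicBlocks n) H, IsFlinn u →
        ∃ i₀, ∀ i, i ≠ i₀ → u i = 0) ∧
    (∀ d : ℕ, ∀ X : KotheSpace (Measure.count : Measure (Fin d)), X.IsRI →
      ¬ X.ProportionalToLp 2 → ∀ u : X.BlockSpace (finBlocks d) H, IsFlinn u →
        ∃ i₀, ∀ i, i ≠ i₀ → u i = 0) ∧
    (∀ X : KotheSpace (Measure.count : Measure ℕ), X.IsRI → ¬ X.ProportionalToLp 2 →
      ∃ N : ℕ, ∀ n ≥ N, ∀ u : X.BlockSpace (natBlocks n) H, IsFlinn u →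
        ∃ i₀, ∀ i, i ≠ i₀ → u i = 0) := by
  refine ⟨fun X hX hX2 => ?_, fun d X hX hX2 => ?_, fun X hX hX2 => ?_⟩
  · exact eventually_atTop.1 (hX.eventually_forall_isFlinn hX2 hH isExchangeable_dyadicBlocks
      isExhausting_dyadicBlocks
      fun n i => ⟨Finset.univ, Finset.mem_univ i, volume_iUnion_dyadicBlocks n⟩)
  · obtain ⟨_, h⟩ := (hX.eventually_forall_isFlinn_count (B := fun _ => finBlocks d) hX2 hH
      (fun _ => .refl _) (fun _ _ => rfl) fun x => .of_forall fun _ => ⟨x, rfl⟩).exists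
    exact h
  · exact eventually_atTop.1 (hX.eventually_forall_isFlinn_count hX2 hH (fun _ => Fin.valEmbedding)
      (fun _ _ => rfl) fun x => (eventually_ge_atTop x).mono fun n hn =>
        ⟨⟨x, hn.trans_lt n.lt_two_pow_self⟩, rfl⟩)

theorem proposition3p1 {H : Type*} [NormedAddCommGroup H] [InnerProductSpace ℝ H]
    [CompleteSpace H] [TopologicalSpace.SeparableSpace H] (hH : 2 ≤ Module.rank ℝ H) :
    -- function spaces on `[0,1]`
    (∀ X : KotheSpace (volume : Measure unitInterval), X.IsRI → X.PropertyP'Interval →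
      (∀ p : ℝ≥0∞, 1 ≤ p → ¬ X.ProportionalToLp p) →
      ∃ N : ℕ, ∀ n ≥ N, ∀ u : X.BlockSpace (dyadicBlocks n) H, IsFlinn u →
        ∃ i₀ : Fin (2 ^ n), ∀ i, i ≠ i₀ → u i = 0) ∧
    -- sequence spaces of finite dimension `d ≥ 3`, where `X_n = X` for all `n`
    (∀ d : ℕ, 3 ≤ d → ∀ X : KotheSpace (Measure.count : Measure (Fin d)),
      X.IsRI → X.PropertyP'Fin →
      (∀ p : ℝ≥0∞, 1 ≤ p → ¬ X.ProportionalToLp p) →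
      ∀ u : X.BlockSpace (finBlocks d) H, IsFlinn u →
        ∃ i₀ : Fin d, ∀ i, i ≠ i₀ → u i = 0) ∧
    -- sequence spaces of infinite dimension
    (∀ X : KotheSpace (Measure.count : Measure ℕ), X.IsRI → X.PropertyP'Nat →
      (∀ p : ℝ≥0∞, 1 ≤ p → ¬ X.ProportionalToLp p) →
      ∃ N : ℕ, ∀ n ≥ N, ∀ u : X.BlockSpace (natBlocks n) H, IsFlinn u →
        ∃ i₀ : Fin (2 ^ n), ∀ i, i ≠ i₀ → u i = 0) := by
  obtain ⟨hInterval, hFin, hNat⟩ := proposition3p1_general (Cardinal.one_lt_two.trans_le hH)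
  exact ⟨fun X hX _ hLp => hInterval X hX (hLp 2 one_le_two),
    fun d _ X hX _ hLp => hFin d X hX (hLp 2 one_le_two),
    fun X hX _ hLp => hNat X hX (hLp 2 one_le_two)⟩
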